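/- We work over $\mathbb C$. An Eckardt cubic threefold $(X,p)$ is a smooth cubic threefold $X\subset\mathbb P^4$ with a point $p\in X$ such that $X\cap T_pX$ is a cone with vertex $p$ over an elliptic curve. Then there is exactly one hyperplane $H\not\ni p$ that is fixed pointwise by an involution of $X$ fixing $p$; put $S=X\cap H$, a cubic surface. Consider (a) triples $(X,p,\ell')$, where $(X,p)$ is an Eckardt cubic threefold and $\ell'\subset X$ is a line through $p$ which meets no line of $S$; (b) triples $(C,\kappa_C,L)$, where $C\subset\mathbb P^2$ is a smooth plane quartic, $\kappa_C$ is an odd theta characteristic on $C$, i.e. the effective divisor $\kappa_C$ with $2\kappa_C=C\cdot M$ for a bitangent $M$ (hyperflex lines included), and $L\subset \mathbb P^2$ is a line meeting $C$ transversely. Theorem. (1) For every triple (a) there are homogeneous coordinates on $\mathbb P^4$ with $p=[0,0,0,0,1]$, $\ell'=\{x_0=x_1=x_2=0\}$ and $$X=\{k x_3^2+2q x_3+c+l x_4^2=0\},\qquad (\ast)$$ where $k,q,c,l\in\mathbb C[x_0,x_1,x_2]$ are forms of degrees $1,2,3,1$. Call such coordinates adapted, and say that projection from $\ell'$ sends $(X,p,\ell')$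 to $C=\{kc-q^2=0\}$, the theta characteristic $\kappa_C$ of the bitangent $\{k=0\}$, and $L=\{l=0\}$. Geometrically, $C\cup L$ is the set of points of $\mathbb P^2$ over which the fibre of the conic fibration given by projection from $\ell'$ is singular, and $\{k=0\}$ is the projection of the tangent plane to $S$ at the point $S\cap\ell'$. (2) Projection from $\ell'$ induces a bijection from triples (a) up to projective equivalence to triples (b) up to projective equivalence. (3) More precisely, let $k,q,c,l\in\mathbb C[x_0,x_1,x_2]$ be forms of degrees $1,2,3,1$, let $N=\begin{pmatrix}k&q\\q&c\end{pmatrix}$, let $X$ be given by $(\ast)$, $p=[0,0,0,0,1]$, $\ell'=\{x_0=x_1=x_2=0\}$. Let $C$ be a plane quartic and $\kappa_C$ the half of the divisor cut on it by a line $M$. Then $(X,p,\ell')$ is a triple (a) with $C=\{kc-q^2=0\}$ and $M=\{k=0\}$ if and only if $(C,\kappa_C,\{l=0\})$ is a triple (b) and there is a presentation $$0\to\mathcal O_{\mathbb P^2}(-2)\oplus\mathcal O_{\mathbb P^2}(-3)\xrightarrow{\;N\;}\mathcal O_{\mathbb P^2}(-1)\oplus\mathcal O_{\mathbb P^2}\to\kappa_C\to0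 .$$ In particular, the cubic $X$ constructed from $(C,\kappa_C,L)$ is smooth. Every pair $(C,\kappa_C)$ has such a presentation. For a given triple (a) and a given choice of the coordinates $x_0,x_1,x_2$, the data $(N,l)$ of adapted coordinates are unique up to $(N,l)\mapsto(A^{T}NA,\,a\,l)$ with $A=\begin{pmatrix}b&\lambda\\0&1\end{pmatrix}$, $a,b\in\mathbb C^*$ and $\lambda$ a linear form, and all these values occur. -/

import Mathlib

open MvPolynomial

noncomputable section

/-- A homogeneous form of degree `d` defining a smooth hypersurface of projective space:
its partial derivatives have no common zero on the hypersurface. -/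
def IsSmoothForm {n : ℕ} (d : ℕ) (F : MvPolynomial (Fin n) ℂ) : Prop :=
  F.IsHomogeneous d ∧
    ∀ v : Fin n → ℂ, v ≠ 0 → eval v F = 0 → ∃ i, eval v (pderiv i F) ≠ 0

/-- The gradient of a form at a vector. -/
def formGradient {n : ℕ} (F : MvPolynomial (Fin n) ℂ) (v : Fin n → ℂ) : Fin n → ℂ :=
  fun i => eval v (pderiv i F)

/-- The (affine cone over the) projectivized tangent space of `F = 0` at the point spanned
by `v`. -/
def tangentSpace {n : ℕ} (F : MvPolynomial (Fin n) ℂ) (v : Fin n → ℂ) :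
    Submodule ℂ (Fin n → ℂ) :=
  LinearMap.ker (∑ i, formGradient F v i • (LinearMap.proj i : (Fin n → ℂ) →ₗ[ℂ] ℂ))

/-- The projective linear subspace `P(U)` is contained in the hypersurface `F = 0`. -/
def VanishesOn {n : ℕ} (F : MvPolynomial (Fin n) ℂ) (U : Submodule ℂ (Fin n → ℂ)) : Prop :=
  ∀ v ∈ U, eval v F = 0

/-- `P(U)` is a line of projective space. -/
def IsLine {n : ℕ} (U : Submodule ℂ (Fin n → ℂ)) : Prop :=
  Module.finrank ℂ U = 2

/-! ### Eckardt cubic threefolds -/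

/-- `p` is an Eckardt point of the cubic threefold `F = 0`: the intersection with the tangent
space at `p` is a cone with vertex `p` over an elliptic curve. The elliptic curve is a smooth
plane cubic `E`, embedded by `φ` as a plane section, away from `p`, of that intersection. -/
def IsEckardtPoint (F : MvPolynomial (Fin 5) ℂ) (p : Projectivization ℂ (Fin 5 → ℂ)) : Prop :=
  VanishesOn F p.submodule ∧
    ∃ (E : MvPolynomial (Fin 3) ℂ) (φ : (Fin 3 → ℂ) →ₗ[ℂ] (Fin 5 → ℂ)),
      IsSmoothForm 3 E ∧
      Function.Injective φ ∧
      Disjoint p.submodule (LinearMap.range φ) ∧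
      p.submodule ⊔ LinearMap.range φ = tangentSpace F p.rep ∧
      ∀ (y : Fin 3 → ℂ), ∀ v ∈ p.submodule, eval (φ y + v) F = eval y E

/-- `P(H)` is the hyperplane fixed pointwise by an involution `τ` of the cubic `F = 0` whose
other fixed point is `p`. The cubic surface attached to `(X, p)` is `S = X ∩ P(H)`. -/
def IsFixedHyperplane (F : MvPolynomial (Fin 5) ℂ) (p : Projectivization ℂ (Fin 5 → ℂ))
    (H : Submodule ℂ (Fin 5 → ℂ)) : Prop :=
  IsCompl H p.submodule ∧
    ∃ τ : (Fin 5 → ℂ) →ₗ[ℂ] (Fin 5 → ℂ),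
      (∀ v ∈ H, τ v = v) ∧ (∀ v ∈ p.submodule, τ v = -v) ∧ ∀ v, eval (τ v) F = eval v F

/-- `(X, p)` is an Eckardt cubic threefold, `X` being given by the equation `F`, and `ℓ` is a
line on `X` through `p` meeting no line of the cubic surface `S`. -/
structure IsEckardtTriple (F : MvPolynomial (Fin 5) ℂ) (p : Projectivization ℂ (Fin 5 → ℂ))
    (ℓ : Submodule ℂ (Fin 5 → ℂ)) : Prop where
  smooth : IsSmoothForm 3 F
  eckardt : IsEckardtPoint F p
  isLine : IsLine ℓ
  mem_line : p.submodule ≤ ℓ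
  line_le : VanishesOn F ℓ
  avoids : ∀ H, IsFixedHyperplane F p H →
    ∀ m : Submodule ℂ (Fin 5 → ℂ), IsLine m → m ≤ H → VanishesOn F m → Disjoint ℓ m

/-- Triples `(X ⊂ P⁴, p, ℓ')`. -/
structure EckardtTriple where
  F : MvPolynomial (Fin 5) ℂ
  p : Projectivization ℂ (Fin 5 → ℂ)
  ℓ : Submodule ℂ (Fin 5 → ℂ)
  isTriple : IsEckardtTriple F p ℓ

/-- Projective equivalence of triples `(X, p, ℓ')`. -/
def EckardtTriple.Equivalent (T T' : EckardtTriple) : Prop :=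
  ∃ (g : (Fin 5 → ℂ) ≃ₗ[ℂ] (Fin 5 → ℂ)) (a : ℂˣ),
    (∀ v, eval (g v) T'.F = a * eval v T.F) ∧
    T.p.submodule.map (g : (Fin 5 → ℂ) →ₗ[ℂ] (Fin 5 → ℂ)) = T'.p.submodule ∧
    T.ℓ.map (g : (Fin 5 → ℂ) →ₗ[ℂ] (Fin 5 → ℂ)) = T'.ℓ

theorem EckardtTriple.equivalence : Equivalence EckardtTriple.Equivalent where
  refl T := ⟨LinearEquiv.refl ℂ _, 1, by simp, by simp, by simp⟩
  symm := by
    rintro T T' ⟨g, a, h, hp, hl⟩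
    refine ⟨g.symm, a⁻¹, fun v => ?_, ?_, ?_⟩
    · have := h (g.symm v)
      rw [LinearEquiv.apply_symm_apply] at this
      rw [this, ← mul_assoc, Units.inv_mul, one_mul]
    · rw [← hp, ← Submodule.map_comp]; simp
    · rw [← hl, ← Submodule.map_comp]; simp
  trans := by
    rintro T T' T'' ⟨g, a, h, hp, hl⟩ ⟨g', a', h', hp', hl'⟩
    refine ⟨g.trans g', a' * a, fun v => ?_, ?_, ?_⟩
    · rw [LinearEquiv.trans_apply, h', h, Units.val_mul, mul_assoc]
    · rw [← hp', ← hp, ← Submodule.map_comp]; rfl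
    · rw [← hl', ← hl, ← Submodule.map_comp]; rfl

def EckardtTriple.setoid : Setoid EckardtTriple :=
  ⟨EckardtTriple.Equivalent, EckardtTriple.equivalence⟩

/-! ### Plane quartics with a bitangent and a transverse line -/

/-- `m = 0` is a bitangent of the plane quartic `Q = 0`: a line which cuts the quartic in twice
an effective divisor, i.e. on which `Q` restricts to the square of a quadratic form (the case of
a hyperflex is included). Half of the divisor of `m` on the quartic is the corresponding odd
theta characteristic. -/
def IsBitangent (Q m : MvPolynomial (Fin 3) ℂ) : Prop :=
  m.IsHomogeneous 1 ∧ m ≠ 0 ∧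
    ∃ h : MvPolynomial (Fin 3) ℂ, h.IsHomogeneous 2 ∧ m ∣ Q - h ^ 2

/-- The line `l = 0` meets the plane curve `Q = 0` transversely. -/
def IsTransverse (Q l : MvPolynomial (Fin 3) ℂ) : Prop :=
  ∀ y : Fin 3 → ℂ, y ≠ 0 → eval y Q = 0 → eval y l = 0 →
    LinearIndependent ℂ ![formGradient Q y, formGradient l y]

/-- `Q = 0` is a smooth plane quartic `C`, `m = 0` is a bitangent (odd theta characteristic
`κ_C`), and `l = 0` is a line `L` transverse to `C`. -/
structure IsQuarticTriple (Q m l : MvPolynomial (Fin 3) ℂ) : Prop where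
  smooth : IsSmoothForm 4 Q
  bitangent : IsBitangent Q m
  line_homogeneous : l.IsHomogeneous 1
  line_ne_zero : l ≠ 0
  transverse : IsTransverse Q l

/-- Triples `(C ⊂ P², κ_C, L)`. -/
structure QuarticTriple where
  Q : MvPolynomial (Fin 3) ℂ
  m : MvPolynomial (Fin 3) ℂ
  l : MvPolynomial (Fin 3) ℂ
  isTriple : IsQuarticTriple Q m l

/-- Projective equivalence of triples `(C, κ_C, L)`. -/
def QuarticTriple.Equivalent (t t' : QuarticTriple) : Prop :=
  ∃ (g : (Fin 3 → ℂ) ≃ₗ[ℂ] (Fin 3 → ℂ)) (a b c : ℂˣ),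
    (∀ y, eval (g y) t'.Q = a * eval y t.Q) ∧
    (∀ y, eval (g y) t'.m = b * eval y t.m) ∧
    (∀ y, eval (g y) t'.l = c * eval y t.l)

theorem QuarticTriple.equivalence : Equivalence QuarticTriple.Equivalent where
  refl t := ⟨LinearEquiv.refl ℂ _, 1, 1, 1, by simp, by simp, by simp⟩
  symm := by
    rintro t t' ⟨g, a, b, c, ha, hb, hc⟩
    refine ⟨g.symm, a⁻¹, b⁻¹, c⁻¹, fun v => ?_, fun v => ?_, fun v => ?_⟩
    · have := ha (g.symm v)
      rw [LinearEquiv.apply_symm_apply] at this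
      rw [this, ← mul_assoc, Units.inv_mul, one_mul]
    · have := hb (g.symm v)
      rw [LinearEquiv.apply_symm_apply] at this
      rw [this, ← mul_assoc, Units.inv_mul, one_mul]
    · have := hc (g.symm v)
      rw [LinearEquiv.apply_symm_apply] at this
      rw [this, ← mul_assoc, Units.inv_mul, one_mul]
  trans := by
    rintro t t' t'' ⟨g, a, b, c, ha, hb, hc⟩ ⟨g', a', b', c', ha', hb', hc'⟩
    refine ⟨g.trans g', a' * a, b' * b, c' * c, fun v => ?_, fun v => ?_, fun v => ?_⟩
    · rw [LinearEquiv.trans_apply, ha', ha, Units.val_mul, mul_assoc]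
    · rw [LinearEquiv.trans_apply, hb', hb, Units.val_mul, mul_assoc]
    · rw [LinearEquiv.trans_apply, hc', hc, Units.val_mul, mul_assoc]

def QuarticTriple.setoid : Setoid QuarticTriple :=
  ⟨QuarticTriple.Equivalent, QuarticTriple.equivalence⟩

/-! ### Presentations of the theta characteristic -/

/-- The homogeneous coordinate ring of the plane curve `Q = 0`. -/
abbrev CoordRing (Q : MvPolynomial (Fin 3) ℂ) : Type :=
  MvPolynomial (Fin 3) ℂ ⧸ Ideal.span {Q}

/-- The homogeneous ideal, in the coordinate ring of the smooth quartic `C : Q = 0`, of the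
effective divisor `κ` with `2 κ = div m`: a form vanishes on `κ` iff its square vanishes on
`div m`, i.e. iff its square is a multiple of `m`. As `O_C(κ) = O_C(1)(-κ)`, the graded module
of sections of all twists of `κ_C` is this ideal, with degrees lowered by one. -/
def thetaIdeal (Q m : MvPolynomial (Fin 3) ℂ) : Ideal (CoordRing Q) :=
  Ideal.span {g | Ideal.Quotient.mk (Ideal.span {Q}) m ∣ g ^ 2}

/-- The symmetric matrix `N`. -/
def quadricMatrix (k q c : MvPolynomial (Fin 3) ℂ) :
    Matrix (Fin 2) (Fin 2) (MvPolynomial (Fin 3) ℂ) :=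
  !![k, q; q, c]

/-- The matrix `N` with entries `k, q, q, c` of degrees `1, 2, 2, 3` is a presentation
`0 ⟶ O(-2) ⊕ O(-3) ⟶ O(-1) ⊕ O ⟶ κ_C ⟶ 0` of the theta characteristic of the curve `Q = 0`
given by the bitangent `m = 0`. It is expressed by graded modules; the degree conditions on `ε`
take into account the degree shift in `thetaIdeal`. -/
def IsPresentation (Q m k q c : MvPolynomial (Fin 3) ℂ) : Prop :=
  k.IsHomogeneous 1 ∧ q.IsHomogeneous 2 ∧ c.IsHomogeneous 3 ∧
    ∃ ε : (Fin 2 → MvPolynomial (Fin 3) ℂ) →ₗ[MvPolynomial (Fin 3) ℂ] thetaIdeal Q m,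
      (∃ s : MvPolynomial (Fin 3) ℂ, s.IsHomogeneous 2 ∧
        (ε (Pi.single 0 1) : CoordRing Q) = Ideal.Quotient.mk (Ideal.span {Q}) s) ∧
      (∃ s : MvPolynomial (Fin 3) ℂ, s.IsHomogeneous 1 ∧
        (ε (Pi.single 1 1) : CoordRing Q) = Ideal.Quotient.mk (Ideal.span {Q}) s) ∧
      Function.Injective (quadricMatrix k q c).mulVecLin ∧
      Function.Exact (quadricMatrix k q c).mulVecLin ε ∧
      Function.Surjective ε

/-! ### Projection from a line through the Eckardt point -/

/-- A form in `x₀, x₁, x₂` viewed as a form in `x₀, …, x₄`. -/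
def liftForm (G : MvPolynomial (Fin 3) ℂ) : MvPolynomial (Fin 5) ℂ :=
  rename (Fin.castLE (by norm_num)) G

/-- The cubic form `k x₃² + 2 q x₃ + c + l x₄²`. -/
def eckardtCubic (k q c l : MvPolynomial (Fin 3) ℂ) : MvPolynomial (Fin 5) ℂ :=
  liftForm k * X 3 ^ 2 + 2 * liftForm q * X 3 + liftForm c + liftForm l * X 4 ^ 2

/-- The point `[0, 0, 0, 0, 1]`. -/
def stdPoint : Projectivization ℂ (Fin 5 → ℂ) :=
  Projectivization.mk ℂ (Pi.single 4 1) (by simp)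

/-- The line `x₀ = x₁ = x₂ = 0`. -/
def stdLine : Submodule ℂ (Fin 5 → ℂ) :=
  Submodule.span ℂ {Pi.single 3 1, Pi.single 4 1}

/-- The first three coordinates: projection from `x₀ = x₁ = x₂ = 0` to the plane. -/
def stdProj : (Fin 5 → ℂ) →ₗ[ℂ] (Fin 3 → ℂ) :=
  LinearMap.funLeft ℂ ℂ (Fin.castLE (by norm_num))

/-- `e` is a system of linear coordinates on `P⁴` in which `p = [0, 0, 0, 0, 1]`, the line `ℓ`
is `x₀ = x₁ = x₂ = 0` and `X` has the equation `k x₃² + 2 q x₃ + c + l x₄² = 0`. -/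
structure IsAdapted (T : EckardtTriple) (e : (Fin 5 → ℂ) ≃ₗ[ℂ] (Fin 5 → ℂ))
    (k q c l : MvPolynomial (Fin 3) ℂ) : Prop where
  hk : k.IsHomogeneous 1
  hq : q.IsHomogeneous 2
  hc : c.IsHomogeneous 3
  hl : l.IsHomogeneous 1
  point : T.p.submodule.map (e : (Fin 5 → ℂ) →ₗ[ℂ] (Fin 5 → ℂ)) = stdPoint.submodule
  line : T.ℓ.map (e : (Fin 5 → ℂ) →ₗ[ℂ] (Fin 5 → ℂ)) = stdLine
  equation : ∀ v, eval v T.F = eval (e v) (eckardtCubic k q c l)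

/-- `(C, κ_C, L)` is the triple obtained by projecting `X` from `ℓ'`: in suitable adapted
coordinates `C` is `k c - q² = 0`, the bitangent is `k = 0` and `L` is `l = 0`.
(Equations are taken up to nonzero constants.) -/
def ProjectsTo (T : EckardtTriple) (t : QuarticTriple) : Prop :=
  ∃ e k q c l, IsAdapted T e k q c l ∧
    Associated t.Q (k * c - q ^ 2) ∧ Associated t.m k ∧ Associated t.l l

/-- For a plane `P(U)` containing the line `P(ℓ)` of the cubic `F = 0`: the conic residual to
the line in the intersection of the cubic with the plane is singular. -/
def ResidualConicSingular (F : MvPolynomial (Fin 5) ℂ) (ℓ U : Submodule ℂ (Fin 5 → ℂ)) : Prop :=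
  ∃ (lam : (Fin 5 → ℂ) →ₗ[ℂ] ℂ) (B : (Fin 5 → ℂ) →ₗ[ℂ] (Fin 5 → ℂ) →ₗ[ℂ] ℂ),
    (∀ v w, B v w = B w v) ∧ U ⊓ LinearMap.ker lam = ℓ ∧
    (∀ v ∈ U, eval v F = lam v * B v v) ∧
    ∃ v ∈ U, v ≠ 0 ∧ ∀ w ∈ U, B v w = 0

end

noncomputable section

/-! Reflection. At an Eckardt point the restriction of `F` to the tangent hyperplane does not
involve the coordinate along `p`. Off this hyperplane `F` is therefore quadratic in that coordinate,
and completing the square produces a reflection preserving `F` (`exists_reflection`). In coordinates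
diagonalizing it, with `ℓ` as `x₀ = x₁ = x₂ = 0`, the odd powers of `x₄` disappear and the shape `k
x₃² + 2 q x₃ + c + l x₄²` is all that is left (`exists_isAdapted`).

Discriminant. Over a point `y` of the plane the residual conic has the Gram matrix made of the
blocks `N = (k, q; q, c)` and `(l)`, hence determinant `l (k c - q²)`. A null vector of the conic
turns into a singular point of the cubic exactly when the differentials of `D = k c - q²` and of `l`
are suitably dependent at `y`. In this way smoothness of the cubic corresponds to smoothness of `D =
0` together with transversality to `l = 0` (`eq_zero_of_smooth`, `surface_ne_smul`). The remaining
condition, that `ℓ` meets no line of `S`, says that `k, q, c` have no common zero: over such a zero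
the line of `S` through `S ∩ ℓ` would appear. Smoothness of `D = 0` implies this condition.

Presentation. On the curve `D = 0` one has `q² = k c`, so `k` and `q` vanish on half of the divisor
of `k`; they generate the theta ideal, and the columns of `N` generate their relations
(`isPresentation_of_associated`). Conversely, degrees alone force every graded presentation by such
an `N` to have determinant `Q` and first entry `m` up to constants (`associated_of_isPresentation`).
Existence is the identity `Q = m c + h² = m c - (i h)²` on a bitangent.

Bijection. Adapted coordinates with the same projection differ by `z ↦ α z + μ(y)`, `t ↦ β t` as far
as the equation can see, that is, by a congruence of `N` and a scaling of `l`
(`IsAdapted.exists_of_stdProj_eq`). If two data have the same `D`, `k`, `l` up to constants, then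
`k` divides `q'² - r q²`, so `q' = ± √r q + k λ`, and the cubics are related by such a substitution
(`exists_presentation_change`, `ProjectsTo.equivalent_left`). -/

/-! ### Forms and linear maps -/

/-- The differential of a polynomial at a vector. -/
def formDiff {n : ℕ} (F : MvPolynomial (Fin n) ℂ) (v : Fin n → ℂ) : (Fin n → ℂ) →ₗ[ℂ] ℂ :=
  ∑ i, formGradient F v i • (LinearMap.proj i : (Fin n → ℂ) →ₗ[ℂ] ℂ)

theorem formDiff_apply {n : ℕ} (F : MvPolynomial (Fin n) ℂ) (v w : Fin n → ℂ) :
    formDiff F v w = ∑ i, eval v (pderiv i F) * w i := by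
  simp [formDiff, formGradient, LinearMap.sum_apply]

theorem tangentSpace_eq_ker {n : ℕ} (F : MvPolynomial (Fin n) ℂ) (v : Fin n → ℂ) :
    tangentSpace F v = LinearMap.ker (formDiff F v) := rfl

theorem formDiff_single {n : ℕ} (F : MvPolynomial (Fin n) ℂ) (v : Fin n → ℂ) (i : Fin n) :
    formDiff F v (Pi.single i 1) = eval v (pderiv i F) := by
  rw [formDiff_apply, Finset.sum_eq_single i] <;> simp +contextual

theorem formDiff_eq_zero_iff {n : ℕ} (F : MvPolynomial (Fin n) ℂ) (v : Fin n → ℂ) :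
    formDiff F v = 0 ↔ ∀ i, eval v (pderiv i F) = 0 := by
  constructor
  · intro h i
    rw [← formDiff_single, h, LinearMap.zero_apply]
  · intro h
    ext i
    simp [formDiff_apply, h]

theorem isSmoothForm_iff {n d : ℕ} (F : MvPolynomial (Fin n) ℂ) :
    IsSmoothForm d F ↔ F.IsHomogeneous d ∧
      ∀ v, v ≠ 0 → eval v F = 0 → formDiff F v ≠ 0 := by
  simp only [IsSmoothForm, ne_eq, formDiff_eq_zero_iff, not_forall]

/-- Identifies the algebraic differential with a derivative along a line, so that the chain rule for
linear substitutions follows from uniqueness of derivatives. -/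
theorem hasDerivAt_eval_line {n : ℕ} (F : MvPolynomial (Fin n) ℂ) (v w : Fin n → ℂ) :
    HasDerivAt (fun t : ℂ => eval (v + t • w) F) (formDiff F v w) 0 := by
  rw [formDiff_apply]
  induction F using MvPolynomial.induction_on with
  | C a => simpa using hasDerivAt_const (0 : ℂ) a
  | add p q hp hq =>
    simpa only [map_add, add_mul, Finset.sum_add_distrib] using hp.fun_add hq
  | mul_X p j hp =>
    have h1 : HasDerivAt (fun t : ℂ => v j + t * w j) (w j) 0 := by
      simpa using ((hasDerivAt_id (0 : ℂ)).mul_const (w j)).const_add (v j)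
    have h2 := hp.mul h1
    simp only [zero_mul, add_zero, zero_smul] at h2
    simp only [map_mul, eval_X, Pi.add_apply, Pi.smul_apply, smul_eq_mul]
    refine h2.congr_deriv ?_
    simp only [Derivation.leibniz, pderiv_X, smul_eq_mul, map_add, map_mul, eval_X, add_mul,
      Finset.sum_add_distrib, Finset.sum_mul]
    rw [add_comm]
    congr 1
    · rw [Finset.sum_eq_single j] <;> simp +contextual [eq_comm]
    · exact Finset.sum_congr rfl fun i _ => by ring

/-- Chain rule for a polynomial composed with a linear map. -/
theorem formDiff_comp {m n : ℕ} {F : MvPolynomial (Fin n) ℂ} {G : MvPolynomial (Fin m) ℂ}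
    (φ : (Fin m → ℂ) →ₗ[ℂ] (Fin n → ℂ)) (h : ∀ v, eval (φ v) F = eval v G) (v w : Fin m → ℂ) :
    formDiff G v w = formDiff F (φ v) (φ w) := by
  have h1 := hasDerivAt_eval_line F (φ v) (φ w)
  simp only [← map_smul, ← map_add, h] at h1
  exact (hasDerivAt_eval_line G v w).unique h1

theorem formDiff_smul_form {n : ℕ} (a : ℂ) (F : MvPolynomial (Fin n) ℂ) (v : Fin n → ℂ) :
    formDiff (C a * F) v = a • formDiff F v := by
  ext i
  simp [formDiff_apply, Derivation.leibniz, Finset.mul_sum, mul_assoc]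

theorem MvPolynomial.IsHomogeneous.eval_smul {n d : ℕ} {F : MvPolynomial (Fin n) ℂ}
    (hF : F.IsHomogeneous d) (s : ℂ) (v : Fin n → ℂ) : eval (s • v) F = s ^ d * eval v F := by
  rw [eval_eq', eval_eq', Finset.mul_sum]
  refine Finset.sum_congr rfl fun e he => ?_
  have := hF.degree_eq_sum_deg_support he
  simp only [Pi.smul_apply, smul_eq_mul, mul_pow, Finset.prod_mul_distrib]
  rw [Finset.prod_pow_eq_pow_sum]
  have h2 : ∑ i, e i = d := by
    rw [← hF (mem_support_iff.mp he), Finsupp.weight_apply, Finsupp.sum_fintype] <;> simp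
  rw [h2]; ring

theorem MvPolynomial.IsHomogeneous.eval_zero {n d : ℕ} {F : MvPolynomial (Fin n) ℂ}
    (hF : F.IsHomogeneous d) (hd : d ≠ 0) : eval 0 F = 0 := by
  have := hF.eval_smul 0 0
  simpa [hd] using this

theorem MvPolynomial.IsHomogeneous.constantCoeff_eq_zero {n d : ℕ} {F : MvPolynomial (Fin n) ℂ}
    (hF : F.IsHomogeneous d) (hd : d ≠ 0) : constantCoeff F = 0 := by
  rw [← hF.eval_zero hd, MvPolynomial.eval_zero]

theorem MvPolynomial.IsHomogeneous.eq_C {n : ℕ} {F : MvPolynomial (Fin n) ℂ}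
    (hF : F.IsHomogeneous 0) : ∃ a, F = C a :=
  ⟨_, totalDegree_eq_zero_iff_eq_C.mp ((totalDegree_zero_iff_isHomogeneous (p := F)).mpr hF)⟩

theorem MvPolynomial.IsHomogeneous.formDiff_self {n d : ℕ} {F : MvPolynomial (Fin n) ℂ}
    (hF : F.IsHomogeneous d) (v : Fin n → ℂ) : formDiff F v v = d * eval v F := by
  have := congrArg (eval v) hF.sum_X_mul_pderiv
  simp only [map_sum, map_mul, eval_X, nsmul_eq_mul, map_natCast] at this
  rw [formDiff_apply, ← this]
  exact Finset.sum_congr rfl fun i _ => mul_comm _ _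

/-- The partial derivatives of a linear form are constants, so the base point is irrelevant and
Euler's identity at `w` applies. -/
theorem MvPolynomial.IsHomogeneous.formDiff_eq_eval {n : ℕ} {k : MvPolynomial (Fin n) ℂ}
    (hk : k.IsHomogeneous 1) (v w : Fin n → ℂ) : formDiff k v w = eval w k := by
  have h := hk.formDiff_self w
  rw [Nat.cast_one, one_mul] at h
  rw [← h, formDiff_apply, formDiff_apply]
  refine Finset.sum_congr rfl fun i _ => ?_
  obtain ⟨a, ha⟩ := (hk.pderiv (i := i)).eq_C
  simp [ha]

/-- The linear functional of a linear form. -/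
theorem MvPolynomial.IsHomogeneous.exists_linear {n : ℕ} {k : MvPolynomial (Fin n) ℂ}
    (hk : k.IsHomogeneous 1) : ∃ L : (Fin n → ℂ) →ₗ[ℂ] ℂ, ∀ v, eval v k = L v :=
  ⟨formDiff k 0, fun v => (hk.formDiff_eq_eval 0 v).symm⟩

/-- The linear form of a linear functional. -/
def linForm {n : ℕ} (L : (Fin n → ℂ) →ₗ[ℂ] ℂ) : MvPolynomial (Fin n) ℂ :=
  ∑ i, C (L (Pi.single i 1)) * X i

theorem linForm_isHomogeneous {n : ℕ} (L : (Fin n → ℂ) →ₗ[ℂ] ℂ) :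
    (linForm L).IsHomogeneous 1 :=
  IsHomogeneous.sum _ _ _ fun _ _ => isHomogeneous_C_mul_X _ _

theorem eval_linForm {n : ℕ} (L : (Fin n → ℂ) →ₗ[ℂ] ℂ) (v : Fin n → ℂ) :
    eval v (linForm L) = L v := by
  conv_rhs => rw [← LinearMap.sum_single_apply (fun _ => ℂ) v]
  simp only [linForm, map_sum, map_mul, eval_C, eval_X]
  refine Finset.sum_congr rfl fun i _ => ?_
  have : (Pi.single i (v i) : Fin n → ℂ) = v i • Pi.single i 1 := by
    rw [← Pi.single_smul, smul_eq_mul, mul_one]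
  rw [this, map_smul, smul_eq_mul, mul_comm]

/-- Composition of a polynomial with a linear map. -/
def pull {m n : ℕ} (φ : (Fin m → ℂ) →ₗ[ℂ] (Fin n → ℂ)) :
    MvPolynomial (Fin n) ℂ →ₐ[ℂ] MvPolynomial (Fin m) ℂ :=
  aeval fun i => linForm (LinearMap.proj i ∘ₗ φ)

@[simp]
theorem eval_pull {m n : ℕ} (φ : (Fin m → ℂ) →ₗ[ℂ] (Fin n → ℂ)) (F : MvPolynomial (Fin n) ℂ)
    (v : Fin m → ℂ) : eval v (pull φ F) = eval (φ v) F := by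
  induction F using MvPolynomial.induction_on with
  | C a => simp [pull]
  | add p q hp hq => rw [map_add, map_add, hp, hq, map_add]
  | mul_X p i hp =>
    rw [map_mul, map_mul, hp, map_mul, eval_X]
    congr 1
    rw [pull, aeval_X, eval_linForm]
    rfl

theorem pull_isHomogeneous {m n d : ℕ} (φ : (Fin m → ℂ) →ₗ[ℂ] (Fin n → ℂ))
    {F : MvPolynomial (Fin n) ℂ} (hF : F.IsHomogeneous d) : (pull φ F).IsHomogeneous d := by
  rw [← one_mul d]
  exact IsHomogeneous.aeval (n := 1) hF _ fun i => linForm_isHomogeneous _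

theorem MvPolynomial.eq_zero_of_eval {n : ℕ} {F : MvPolynomial (Fin n) ℂ}
    (h : ∀ v, eval v F = 0) : F = 0 :=
  MvPolynomial.funext fun v => by rw [h v, map_zero]

theorem exists_eval_ne_zero {n : ℕ} {F : MvPolynomial (Fin n) ℂ} (h : F ≠ 0) :
    ∃ v, eval v F ≠ 0 := by
  by_contra! H
  exact h (eq_zero_of_eval H)

theorem isSmoothForm_of_equiv {n d : ℕ} {F G : MvPolynomial (Fin n) ℂ}
    (g : (Fin n → ℂ) ≃ₗ[ℂ] (Fin n → ℂ)) (h : ∀ v, eval v F = eval (g v) G)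
    (hF : IsSmoothForm d F) : IsSmoothForm d G := by
  rw [isSmoothForm_iff] at hF ⊢
  have hG : G = pull (g.symm : (Fin n → ℂ) →ₗ[ℂ] (Fin n → ℂ)) F :=
    MvPolynomial.funext fun v => by simp [h]
  refine ⟨hG ▸ pull_isHomogeneous _ hF.1, fun v hv hv0 hd => ?_⟩
  refine hF.2 (g.symm v) (by simpa using hv) (by simpa [h] using hv0) ?_
  refine LinearMap.ext fun w => ?_
  rw [formDiff_comp (F := G) (g : (Fin n → ℂ) →ₗ[ℂ] (Fin n → ℂ)) (fun v => (h v).symm)]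
  simp [hd]

/-! ### Divisibility by linear forms -/

theorem MvPolynomial.IsHomogeneous.irreducible_of_one {n : ℕ} {k : MvPolynomial (Fin n) ℂ}
    (hk : k.IsHomogeneous 1) (h0 : k ≠ 0) : Irreducible k := by
  refine irreducible_of_totalDegree_eq_one (hk.totalDegree h0) fun x hx => ?_
  obtain ⟨i, hi⟩ := ne_zero_iff.mp h0
  exact isUnit_iff_ne_zero.mpr fun h => hi (by simpa [h] using hx i)

/-- A polynomial vanishing on the kernel of a nonzero linear form is a multiple of it. -/
theorem dvd_of_vanishing {n : ℕ} {k P : MvPolynomial (Fin n) ℂ}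
    (hk : k.IsHomogeneous 1) (h0 : k ≠ 0) (h : ∀ v, eval v k = 0 → eval v P = 0) : k ∣ P := by
  have hp : Prime k := (hk.irreducible_of_one h0).prime
  have : (Ideal.span {k}).IsPrime := (Ideal.span_singleton_prime h0).mpr hp
  -- Nullstellensatz: a prime ideal is the vanishing ideal of its zero locus.
  rw [← Ideal.mem_span_singleton, ← IsPrime.vanishingIdeal_zeroLocus (K := ℂ) (Ideal.span {k})]
  intro v hv
  have := hv k (Ideal.mem_span_singleton_self k)
  rw [aeval_eq_eval] at this ⊢
  exact h v this

/-- Multiplication by a linear form shifts the grading by one. This makes quotients of forms by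
linear forms homogeneous and keeps expansions in the variables homogeneous. -/
theorem MvPolynomial.IsHomogeneous.homogeneousComponent_mul_one {n : ℕ}
    {k : MvPolynomial (Fin n) ℂ} (hk : k.IsHomogeneous 1) (Q : MvPolynomial (Fin n) ℂ) (e : ℕ) :
    homogeneousComponent (e + 1) (k * Q) = k * homogeneousComponent e Q := by
  conv_lhs => rw [← sum_homogeneousComponent Q, Finset.mul_sum, map_sum]
  have : ∀ i, homogeneousComponent (e + 1) (k * homogeneousComponent i Q) =
      if i = e then k * homogeneousComponent i Q else 0 := by
    intro i
    rw [homogeneousComponent_of_mem (m := e + 1) (n := i + 1)]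
    · simp [eq_comm]
    · rw [add_comm i 1]; exact hk.mul (homogeneousComponent_isHomogeneous i Q)
  simp only [this, Finset.sum_ite_eq', Finset.mem_range]
  split_ifs with hlt
  · rfl
  · rw [homogeneousComponent_eq_zero _ _ (by omega), mul_zero]

theorem MvPolynomial.IsHomogeneous.of_mul_one {n d : ℕ} {k P : MvPolynomial (Fin n) ℂ}
    (hk : k.IsHomogeneous 1) (h0 : k ≠ 0) (h : (k * P).IsHomogeneous (d + 1)) :
    P.IsHomogeneous d := by
  have := hk.homogeneousComponent_mul_one P d
  rw [homogeneousComponent_of_mem h, if_pos rfl] at this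
  rw [mul_left_cancel₀ h0 this]
  exact homogeneousComponent_isHomogeneous d P

theorem associated_iff_C_mul {n : ℕ} {F G : MvPolynomial (Fin n) ℂ} :
    Associated F G ↔ ∃ a : ℂ, a ≠ 0 ∧ F = C a * G := by
  constructor
  · intro h
    obtain ⟨u, hu⟩ := h.symm
    obtain ⟨r, hr, hr'⟩ := isUnit_iff_eq_C_of_isReduced.mp u.isUnit
    exact ⟨r, hr.ne_zero, by rw [← hu, hr', mul_comm]⟩
  · rintro ⟨a, ha, rfl⟩
    exact associated_unit_mul_left _ _ ((isUnit_iff_ne_zero.mpr ha).map C)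

/-! ### Zeros of forms on lines -/

theorem exists_basis_ker {k : (Fin 3 → ℂ) →ₗ[ℂ] ℂ} (hk : k ≠ 0) :
    ∃ (j : (Fin 2 → ℂ) →ₗ[ℂ] (Fin 3 → ℂ)), Function.Injective j ∧
      LinearMap.range j = LinearMap.ker k := by
  have hr : Module.finrank ℂ (LinearMap.ker k) = 2 := by
    have := LinearMap.finrank_range_add_finrank_ker k
    rw [LinearMap.range_eq_top.mpr (LinearMap.surjective hk)] at this
    simp at this
    omega
  let e : (Fin 2 → ℂ) ≃ₗ[ℂ] LinearMap.ker k := LinearEquiv.ofFinrankEq _ _ (by simp [hr])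
  refine ⟨(LinearMap.ker k).subtype ∘ₗ e, ?_, ?_⟩
  · exact Subtype.val_injective.comp e.injective
  · rw [LinearMap.range_comp, LinearEquiv.range, Submodule.map_top, Submodule.range_subtype]

/-- A binary form of positive degree has a nontrivial zero. -/
theorem exists_zero_binary {d : ℕ} {P : MvPolynomial (Fin 2) ℂ}
    (hP : P.IsHomogeneous d) : d ≠ 0 → ∃ v, v ≠ 0 ∧ eval v P = 0 := by
  intro hd
  by_contra! H
  -- The two dehomogenizations `P(1, X)` and `P(X, 1)`. Without nontrivial zeros the first has no
  -- root, hence is a constant `c`; homogeneity then makes the second `c X ^ d`, which vanishes at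
  -- `0` because `d ≠ 0`.
  let p : Polynomial ℂ := aeval ![1, Polynomial.X] P
  let r : Polynomial ℂ := aeval ![Polynomial.X, 1] P
  have hp : ∀ t, p.eval t = eval ![1, t] P := by
    intro t
    rw [← Polynomial.coe_aeval_eq_eval, ← aeval_eq_eval, Polynomial.coe_aeval_eq_eval]
    change Polynomial.aeval t (aeval _ P) = _
    rw [comp_aeval_apply _ (Polynomial.aeval t) P]; congr 2; ext i; fin_cases i <;> simp
  have hr : ∀ t, r.eval t = eval ![t, 1] P := by
    intro t
    rw [← Polynomial.coe_aeval_eq_eval, ← aeval_eq_eval, Polynomial.coe_aeval_eq_eval]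
    change Polynomial.aeval t (aeval _ P) = _
    rw [comp_aeval_apply _ (Polynomial.aeval t) P]; congr 2; ext i; fin_cases i <;> simp
  have hconst : p.degree = 0 := by
    by_contra hne
    obtain ⟨t, ht⟩ := IsAlgClosed.exists_root p hne
    refine H ![1, t] (fun h => by simpa using congrFun h 0) ?_
    rw [← hp]; exact ht
  obtain ⟨c, hc⟩ : ∃ c, p = Polynomial.C c := ⟨_, Polynomial.eq_C_of_degree_eq_zero hconst⟩
  have hr2 : r = Polynomial.C c * Polynomial.X ^ d := by
    apply Polynomial.eq_of_infinite_eval_eq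
    refine (Set.infinite_of_finite_compl (s := {0}ᶜ) (by simp)).mono fun s hs => ?_
    have hs0 : s ≠ 0 := hs
    have e1 := hp s⁻¹
    have e2 := hP.eval_smul s ![1, s⁻¹]
    rw [← e1, hc] at e2
    have e3 : s • ![1, s⁻¹] = ![s, 1] := by
      ext i; fin_cases i <;> simp [hs0]
    rw [e3, ← hr] at e2
    simpa only [Polynomial.eval_mul, Polynomial.eval_C, Polynomial.eval_pow, Polynomial.eval_X,
      mul_comm, Set.mem_ofPred_eq] using e2
  refine H ![0, 1] (fun h => by simpa using congrFun h 1) ?_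
  rw [← hr, hr2]
  simp [hd]

/-- A line and a plane curve have a common point. -/
theorem exists_common_zero {d : ℕ} {k P : MvPolynomial (Fin 3) ℂ} (hk : k.IsHomogeneous 1)
    (hP : P.IsHomogeneous d) (hd : d ≠ 0) : ∃ y, y ≠ 0 ∧ eval y k = 0 ∧ eval y P = 0 := by
  obtain ⟨j, hj, hkj⟩ : ∃ j : (Fin 2 → ℂ) →ₗ[ℂ] (Fin 3 → ℂ), Function.Injective j ∧
      ∀ v, eval (j v) k = 0 := by
    obtain ⟨L, hL⟩ := hk.exists_linear
    by_cases h0 : L = 0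
    -- For `k = 0` any injection of a plane serves; this one is `(a, b) ↦ (a, b, b)`.
    · refine ⟨LinearMap.funLeft ℂ ℂ ![0, 1, 1],
        LinearMap.funLeft_injective_of_surjective ℂ ℂ _ ?_, fun v => by simp [hL, h0]⟩
      intro i; fin_cases i
      exacts [⟨0, rfl⟩, ⟨1, rfl⟩]
    · obtain ⟨j, hj, hr⟩ := exists_basis_ker h0
      refine ⟨j, hj, fun v => ?_⟩
      rw [hL]
      exact LinearMap.mem_ker.mp (hr ▸ LinearMap.mem_range_self j v)
  obtain ⟨v, hv, hv0⟩ := exists_zero_binary (pull_isHomogeneous j hP) hd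
  exact ⟨j v, fun h => hv (hj (by rw [h, map_zero])), hkj v, by simpa using hv0⟩

/-! ### The cubic in coordinates -/

/-- The vector with coordinates `y, z, t`. -/
def vec5 (y : Fin 3 → ℂ) (z t : ℂ) : Fin 5 → ℂ := ![y 0, y 1, y 2, z, t]

@[simp] theorem vec5_three (y : Fin 3 → ℂ) (z t : ℂ) : vec5 y z t 3 = z := rfl
@[simp] theorem vec5_four (y : Fin 3 → ℂ) (z t : ℂ) : vec5 y z t 4 = t := rfl

@[simp] theorem stdProj_vec5 (y : Fin 3 → ℂ) (z t : ℂ) : stdProj (vec5 y z t) = y := by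
  ext i; fin_cases i <;> rfl

theorem vec5_eta (v : Fin 5 → ℂ) : vec5 (stdProj v) (v 3) (v 4) = v := by
  ext i; fin_cases i <;> rfl

theorem vec5_add (y y' : Fin 3 → ℂ) (z z' t t' : ℂ) :
    vec5 y z t + vec5 y' z' t' = vec5 (y + y') (z + z') (t + t') := by
  ext i; fin_cases i <;> rfl

theorem smul_vec5 (s : ℂ) (y : Fin 3 → ℂ) (z t : ℂ) :
    s • vec5 y z t = vec5 (s • y) (s * z) (s * t) := by
  ext i; fin_cases i <;> rfl

theorem vec5_inj {y y' : Fin 3 → ℂ} {z z' t t' : ℂ} :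
    vec5 y z t = vec5 y' z' t' ↔ y = y' ∧ z = z' ∧ t = t' := by
  constructor
  · intro h
    exact ⟨by simpa using congrArg stdProj h, congrFun h 3, congrFun h 4⟩
  · rintro ⟨rfl, rfl, rfl⟩; rfl

theorem vec5_zero : vec5 0 0 0 = 0 := by
  ext i; fin_cases i <;> rfl

theorem vec5_eq_zero_iff {y : Fin 3 → ℂ} {z t : ℂ} : vec5 y z t = 0 ↔ y = 0 ∧ z = 0 ∧ t = 0 := by
  rw [← vec5_zero, vec5_inj]

theorem single_three : (Pi.single 3 1 : Fin 5 → ℂ) = vec5 0 1 0 := by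
  ext i; fin_cases i <;> rfl

theorem single_four : (Pi.single 4 1 : Fin 5 → ℂ) = vec5 0 0 1 := by
  ext i; fin_cases i <;> rfl

@[simp] theorem eval_liftForm (G : MvPolynomial (Fin 3) ℂ) (v : Fin 5 → ℂ) :
    eval v (liftForm G) = eval (stdProj v) G := by
  rw [liftForm, eval_rename]; rfl

theorem eval_eckardtCubic (k q c l : MvPolynomial (Fin 3) ℂ) (v : Fin 5 → ℂ) :
    eval v (eckardtCubic k q c l) = eval (stdProj v) k * v 3 ^ 2 + 2 * eval (stdProj v) q * v 3 +
      eval (stdProj v) c + eval (stdProj v) l * v 4 ^ 2 := by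
  simp [eckardtCubic]

theorem formDiff_mul {n : ℕ} (A B : MvPolynomial (Fin n) ℂ) (v w : Fin n → ℂ) :
    formDiff (A * B) v w = eval v A * formDiff B v w + eval v B * formDiff A v w := by
  simp only [formDiff_apply, Derivation.leibniz, smul_eq_mul, map_add, map_mul, add_mul,
    Finset.sum_add_distrib, Finset.mul_sum, mul_assoc]

theorem formDiff_add {n : ℕ} (A B : MvPolynomial (Fin n) ℂ) (v w : Fin n → ℂ) :
    formDiff (A + B) v w = formDiff A v w + formDiff B v w := by
  simp only [formDiff_apply, map_add, add_mul, Finset.sum_add_distrib]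

theorem formDiff_sub {n : ℕ} (A B : MvPolynomial (Fin n) ℂ) (v w : Fin n → ℂ) :
    formDiff (A - B) v w = formDiff A v w - formDiff B v w := by
  simp only [formDiff_apply, map_sub, sub_mul, Finset.sum_sub_distrib]

theorem formDiff_X {n : ℕ} (i : Fin n) (v w : Fin n → ℂ) : formDiff (X i) v w = w i := by
  rw [(isHomogeneous_X ℂ i).formDiff_eq_eval, eval_X]

theorem formDiff_liftForm (G : MvPolynomial (Fin 3) ℂ) (v w : Fin 5 → ℂ) :
    formDiff (liftForm G) v w = formDiff G (stdProj v) (stdProj w) :=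
  formDiff_comp stdProj (fun v => (eval_liftForm G v).symm) v w

theorem formDiff_eckardtCubic (k q c l : MvPolynomial (Fin 3) ℂ) (v w : Fin 5 → ℂ) :
    formDiff (eckardtCubic k q c l) v w =
      formDiff k (stdProj v) (stdProj w) * v 3 ^ 2 + 2 * formDiff q (stdProj v) (stdProj w) * v 3 +
      formDiff c (stdProj v) (stdProj w) + formDiff l (stdProj v) (stdProj w) * v 4 ^ 2 +
      2 * (eval (stdProj v) k * v 3 + eval (stdProj v) q) * w 3 +
      2 * eval (stdProj v) l * v 4 * w 4 := by
  have h2 : (2 : MvPolynomial (Fin 5) ℂ) = C 2 := (map_ofNat C 2).symm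
  simp only [eckardtCubic, pow_two, formDiff_add, formDiff_mul, formDiff_X, formDiff_liftForm, h2,
    formDiff_smul_form, LinearMap.smul_apply, smul_eq_mul, eval_X, map_mul, eval_liftForm, eval_C]
  ring

theorem formDiff_discriminant (k q c : MvPolynomial (Fin 3) ℂ) (y w : Fin 3 → ℂ) :
    formDiff (k * c - q ^ 2) y w =
      eval y k * formDiff c y w + eval y c * formDiff k y w - 2 * eval y q * formDiff q y w := by
  simp only [pow_two, formDiff_sub, formDiff_mul]
  ring

theorem discriminant_isHomogeneous {k q c : MvPolynomial (Fin 3) ℂ} (hk : k.IsHomogeneous 1)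
    (hq : q.IsHomogeneous 2) (hc : c.IsHomogeneous 3) : (k * c - q ^ 2).IsHomogeneous 4 :=
  (hk.mul hc).sub (hq.pow 2)

theorem liftForm_isHomogeneous {d : ℕ} {G : MvPolynomial (Fin 3) ℂ} (h : G.IsHomogeneous d) :
    (liftForm G).IsHomogeneous d := h.rename_isHomogeneous

theorem eckardtCubic_isHomogeneous {k q c l : MvPolynomial (Fin 3) ℂ} (hk : k.IsHomogeneous 1)
    (hq : q.IsHomogeneous 2) (hc : c.IsHomogeneous 3) (hl : l.IsHomogeneous 1) :
    (eckardtCubic k q c l).IsHomogeneous 3 := by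
  have h2 : (2 : MvPolynomial (Fin 5) ℂ) = C 2 := (map_ofNat C 2).symm
  rw [eckardtCubic, h2]
  refine (((IsHomogeneous.mul (liftForm_isHomogeneous hk) (isHomogeneous_X_pow 3 2)).add ?_).add
    (liftForm_isHomogeneous hc)).add
    ((liftForm_isHomogeneous hl).mul (isHomogeneous_X_pow 4 2))
  exact ((liftForm_isHomogeneous hq).C_mul 2).mul (isHomogeneous_X ℂ 3)

/-! ### Expansion in the last two variables -/

theorem exists_eq_liftForm_add (P : MvPolynomial (Fin 5) ℂ) :
    ∃ A P₃ P₄, P = liftForm A + X 3 * P₃ + X 4 * P₄ := by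
  induction P using MvPolynomial.induction_on with
  | C a => exact ⟨C a, 0, 0, by simp [liftForm]⟩
  | add p q hp hq =>
    obtain ⟨A, B, D, rfl⟩ := hp
    obtain ⟨A', B', D', rfl⟩ := hq
    exact ⟨A + A', B + B', D + D', by simp only [liftForm, map_add]; ring⟩
  | mul_X p i hp =>
    obtain ⟨A, B, D, rfl⟩ := hp
    by_cases h3 : i = 3
    · subst h3
      exact ⟨0, liftForm A + X 3 * B + X 4 * D, 0, by simp only [liftForm, map_zero]; ring⟩
    by_cases h4 : i = 4
    · subst h4
      exact ⟨0, 0, liftForm A + X 3 * B + X 4 * D, by simp only [liftForm, map_zero]; ring⟩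
    obtain ⟨j, rfl⟩ : ∃ j : Fin 3, i = Fin.castLE (by norm_num) j :=
      ⟨⟨i, by omega⟩, rfl⟩
    refine ⟨A * X j, B * X (Fin.castLE (by norm_num) j), D * X (Fin.castLE (by norm_num) j), ?_⟩
    simp only [liftForm, map_mul, rename_X]; ring

/-- A form of positive degree is a form in the first three variables plus multiples of the
others. -/
theorem MvPolynomial.IsHomogeneous.exists_eq_liftForm_add {d : ℕ} {P : MvPolynomial (Fin 5) ℂ}
    (hP : P.IsHomogeneous (d + 1)) :
    ∃ A P₃ P₄, A.IsHomogeneous (d + 1) ∧ P₃.IsHomogeneous d ∧ P₄.IsHomogeneous d ∧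
      P = liftForm A + X 3 * P₃ + X 4 * P₄ := by
  obtain ⟨A, B, D, h⟩ := _root_.exists_eq_liftForm_add P
  refine ⟨homogeneousComponent (d + 1) A, homogeneousComponent d B, homogeneousComponent d D,
    homogeneousComponent_isHomogeneous _ _, homogeneousComponent_isHomogeneous _ _,
    homogeneousComponent_isHomogeneous _ _, ?_⟩
  rw [← homogeneousComponent_eq_self hP]
  conv_lhs => rw [h]
  rw [map_add, map_add, (isHomogeneous_X ℂ _).homogeneousComponent_mul_one,
    (isHomogeneous_X ℂ _).homogeneousComponent_mul_one, liftForm, ← rename_homogeneousComponent]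
  rfl

/-- Expansion of a cubic form with respect to the last two variables. -/
theorem exists_cubic_expansion {P : MvPolynomial (Fin 5) ℂ} (hP : P.IsHomogeneous 3) :
    ∃ (c b₃ b₄ a₃₃ a₃₄ a₄₄ : MvPolynomial (Fin 3) ℂ) (r₁ r₂ r₃ r₄ : ℂ),
      c.IsHomogeneous 3 ∧ b₃.IsHomogeneous 2 ∧ b₄.IsHomogeneous 2 ∧ a₃₃.IsHomogeneous 1 ∧
      a₃₄.IsHomogeneous 1 ∧ a₄₄.IsHomogeneous 1 ∧
      ∀ y z t, eval (vec5 y z t) P = eval y c + eval y b₃ * z + eval y b₄ * t +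
        eval y a₃₃ * z ^ 2 + eval y a₃₄ * (z * t) + eval y a₄₄ * t ^ 2 +
        r₁ * z ^ 3 + r₂ * (z ^ 2 * t) + r₃ * (z * t ^ 2) + r₄ * t ^ 3 := by
  obtain ⟨c, P₃, P₄, hc, h3, h4, e⟩ := hP.exists_eq_liftForm_add
  obtain ⟨b₃, P₃₃, P₃₄, hb3, h33, h34, e3⟩ := h3.exists_eq_liftForm_add
  obtain ⟨b₄, P₄₃, P₄₄, hb4, h43, h44, e4⟩ := h4.exists_eq_liftForm_add
  obtain ⟨a₃₃, A₁, A₂, ha33, hA1, hA2, e33⟩ := h33.exists_eq_liftForm_add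
  obtain ⟨a₃₄, A₃, A₄, ha34, hA3, hA4, e34⟩ := h34.exists_eq_liftForm_add
  obtain ⟨a₄₃, A₅, A₆, ha43, hA5, hA6, e43⟩ := h43.exists_eq_liftForm_add
  obtain ⟨a₄₄, A₇, A₈, ha44, hA7, hA8, e44⟩ := h44.exists_eq_liftForm_add
  obtain ⟨s₁, rfl⟩ := hA1.eq_C
  obtain ⟨s₂, rfl⟩ := hA2.eq_C
  obtain ⟨s₃, rfl⟩ := hA3.eq_C
  obtain ⟨s₄, rfl⟩ := hA4.eq_C
  obtain ⟨s₅, rfl⟩ := hA5.eq_C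
  obtain ⟨s₆, rfl⟩ := hA6.eq_C
  obtain ⟨s₇, rfl⟩ := hA7.eq_C
  obtain ⟨s₈, rfl⟩ := hA8.eq_C
  refine ⟨c, b₃, b₄, a₃₃, a₃₄ + a₄₃, a₄₄, s₁, s₂ + s₃ + s₅, s₄ + s₆ + s₇, s₈, hc, hb3, hb4, ha33,
    ha34.add ha43, ha44, fun y z t => ?_⟩
  rw [e, e3, e4, e33, e34, e43, e44]
  simp only [map_add, map_mul, eval_X, eval_C, eval_liftForm, stdProj_vec5, vec5_three, vec5_four]
  ring

/-- Rephrases independence of gradients through differentials, to which the chain and product rules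
apply. -/
theorem isTransverse_iff {Q l : MvPolynomial (Fin 3) ℂ} :
    IsTransverse Q l ↔ ∀ y, y ≠ 0 → eval y Q = 0 → eval y l = 0 →
      ∀ s t : ℂ, s • formDiff Q y + t • formDiff l y = 0 → s = 0 ∧ t = 0 := by
  have key : ∀ (y : Fin 3 → ℂ) (s t : ℂ), s • formGradient Q y + t • formGradient l y = 0 ↔
      s • formDiff Q y + t • formDiff l y = 0 := by
    intro y s t
    constructor
    · intro h
      refine LinearMap.pi_ext' fun i => LinearMap.ext_ring ?_
      have := congrFun h i
      simpa [formDiff_single, formGradient] using this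
    · intro h
      funext i
      have := LinearMap.congr_fun h (Pi.single i 1)
      simpa [formDiff_single, formGradient] using this
  simp only [IsTransverse, LinearIndependent.pair_iff, key]

/-! ### The cubic threefold and its discriminant -/

section Discriminant

variable {k q c l : MvPolynomial (Fin 3) ℂ}

/-- At `y = 0` the differentials of `q` and `c` vanish, being of degree at least one in `y`, and
only the two linear forms survive. This computes the tangent spaces at `p` and at `S ∩ ℓ`, and
controls singularities on the line. -/
theorem formDiff_eckardtCubic_stdLine (v : Fin 5 → ℂ) (hk : k.IsHomogeneous 1)
    (hq : q.IsHomogeneous 2) (hc : c.IsHomogeneous 3) (hl : l.IsHomogeneous 1) (z t : ℂ) :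
    formDiff (eckardtCubic k q c l) (vec5 0 z t) v =
      eval (stdProj v) k * z ^ 2 + eval (stdProj v) l * t ^ 2 := by
  have hc0 : formDiff c 0 = 0 := (formDiff_eq_zero_iff _ _).2 fun i =>
    (hc.pderiv (i := i)).eval_zero (by norm_num)
  have hq0 : formDiff q 0 = 0 := (formDiff_eq_zero_iff _ _).2 fun i =>
    (hq.pderiv (i := i)).eval_zero (by norm_num)
  rw [formDiff_eckardtCubic]
  simp [hk.formDiff_eq_eval, hl.formDiff_eq_eval, hq.constantCoeff_eq_zero, hl.constantCoeff_eq_zero, hk.constantCoeff_eq_zero,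
    hc0, hq0]

theorem eval_eckardtCubic_stdLine (hk : k.IsHomogeneous 1)
    (hq : q.IsHomogeneous 2) (hc : c.IsHomogeneous 3) (hl : l.IsHomogeneous 1) (z t : ℂ) :
    eval (vec5 0 z t) (eckardtCubic k q c l) = 0 := by
  simp [eval_eckardtCubic, hk.constantCoeff_eq_zero, hq.constantCoeff_eq_zero, hc.constantCoeff_eq_zero, hl.constantCoeff_eq_zero]

/-- For `l = 0` the cubic is a cone with vertex `p`, hence singular there. -/
theorem line_ne_zero_of_smooth (hk : k.IsHomogeneous 1)
    (hq : q.IsHomogeneous 2) (hc : c.IsHomogeneous 3) (hl : l.IsHomogeneous 1)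
    (hS : IsSmoothForm 3 (eckardtCubic k q c l)) : l ≠ 0 := by
  rintro rfl
  rw [isSmoothForm_iff] at hS
  refine hS.2 (vec5 0 0 1) (by simp [vec5_eq_zero_iff]) ?_ ?_
  · simp [eval_eckardtCubic, hc.constantCoeff_eq_zero]
  · exact LinearMap.ext fun w => by
      rw [formDiff_eckardtCubic_stdLine w hk hq hc hl]; simp

/-- A point where a combination of the differentials of the discriminant and of `l` vanishes
gives a singular point of the cubic threefold. -/
theorem eq_zero_of_smooth (hk : k.IsHomogeneous 1)
    (hq : q.IsHomogeneous 2) (hc : c.IsHomogeneous 3) (hl : l.IsHomogeneous 1)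
    (hS : IsSmoothForm 3 (eckardtCubic k q c l))
    (hav : ∀ y, eval y k = 0 → eval y q = 0 → eval y c = 0 → y = 0) {y : Fin 3 → ℂ}
    (hQ : eval y (k * c - q ^ 2) = 0) {μ : ℂ} (hμ : μ * eval y l = 0)
    (hd : formDiff (k * c - q ^ 2) y = μ • formDiff l y) : y = 0 := by
  by_contra hy
  rw [isSmoothForm_iff] at hS
  have hQ' : eval y k * eval y c = eval y q ^ 2 := by
    simpa [sub_eq_zero] using hQ
  have hd' : ∀ w, eval y k * formDiff c y w + eval y c * formDiff k y w
      - 2 * eval y q * formDiff q y w = μ * formDiff l y w := by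
    intro w
    rw [← formDiff_discriminant, hd]; rfl
  by_cases hk0 : eval y k = 0
  · have hq0 : eval y q = 0 := by
      rw [hk0, zero_mul] at hQ'
      exact (pow_eq_zero_iff two_ne_zero).mp hQ'.symm
    have hc0 : eval y c ≠ 0 := fun h => hy (hav y hk0 hq0 h)
    -- Here the differential of the discriminant is `c(y) k`, so `c(y) k = μ l` as linear forms. The
    -- singular point lies on the line: at `(0, 1, t)` the differential is `k + t² l`, zero for `t²
    -- = -μ / c(y)`.
    obtain ⟨t, ht⟩ := IsAlgClosed.exists_pow_nat_eq (-(μ / eval y c)) two_pos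
    refine hS.2 (vec5 0 1 t) (by simp [vec5_eq_zero_iff])
      (eval_eckardtCubic_stdLine hk hq hc hl 1 t) (LinearMap.ext fun w => ?_)
    rw [formDiff_eckardtCubic_stdLine w hk hq hc hl, ht]
    have := hd' (stdProj w)
    rw [hk.formDiff_eq_eval, hl.formDiff_eq_eval, hk0, hq0] at this
    simp only [LinearMap.zero_apply]
    field_simp
    linear_combination this
  -- Here the singular point lies over `y`. The value `z = -q/k` kills the `x₃`-derivative and turns
  -- the part of the differential coming from `k, q, c` into `dD / k = (μ / k) dl`, which `t² = -μ /
  -- k` cancels.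
  · obtain ⟨t, ht⟩ := IsAlgClosed.exists_pow_nat_eq (-(μ / eval y k)) two_pos
    have hlt : eval y l * t = 0 := by
      rcases mul_eq_zero.mp hμ with h | h
      · have : t = 0 := by simpa [h] using ht
        simp [this]
      · simp [h]
    have hz : eval y k * (-eval y q / eval y k) + eval y q = 0 := by field_simp; ring
    refine hS.2 (vec5 y (-eval y q / eval y k) t) (by simp [vec5_eq_zero_iff, hy]) ?_
      (LinearMap.ext fun w => ?_)
    · rw [eval_eckardtCubic]
      simp only [stdProj_vec5, vec5_three, vec5_four]
      have : eval y l * t ^ 2 = 0 := by rw [pow_two, ← mul_assoc, hlt, zero_mul]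
      rw [this]
      field_simp
      linear_combination hQ'
    · rw [formDiff_eckardtCubic]
      simp only [stdProj_vec5, vec5_three, vec5_four, LinearMap.zero_apply]
      rw [hz, mul_assoc 2 (eval y l), hlt, ht]
      have := hd' (stdProj w)
      have e : eval y c = eval y q ^ 2 / eval y k := by field_simp; linear_combination hQ'
      rw [e] at this
      field_simp at this ⊢
      linear_combination this

/-- Both claims are instances of `eq_zero_of_smooth`: a singular point of the quartic is the case `μ
= 0`, a tangency with `l = 0` is the case `l(y) = 0`. -/
theorem quartic_of_smooth (hk : k.IsHomogeneous 1)
    (hq : q.IsHomogeneous 2) (hc : c.IsHomogeneous 3) (hl : l.IsHomogeneous 1)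
    (hS : IsSmoothForm 3 (eckardtCubic k q c l))
    (hav : ∀ y, eval y k = 0 → eval y q = 0 → eval y c = 0 → y = 0) :
    IsSmoothForm 4 (k * c - q ^ 2) ∧ IsTransverse (k * c - q ^ 2) l := by
  constructor
  · rw [isSmoothForm_iff]
    refine ⟨discriminant_isHomogeneous hk hq hc, fun y hy hQ hd => hy ?_⟩
    exact eq_zero_of_smooth hk hq hc hl hS hav hQ (μ := 0) (zero_mul _) (by rw [hd, zero_smul])
  · rw [isTransverse_iff]
    intro y hy hQ hly s t hst
    have hs : s = 0 := by
      by_contra hs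
      refine hy (eq_zero_of_smooth hk hq hc hl hS hav hQ (μ := -(t / s)) (by simp [hly]) ?_)
      refine LinearMap.ext fun w => ?_
      have := LinearMap.congr_fun hst w
      simp only [LinearMap.add_apply, LinearMap.smul_apply, smul_eq_mul,
        LinearMap.zero_apply] at this ⊢
      field_simp
      linear_combination this
    refine ⟨hs, ?_⟩
    subst hs
    obtain ⟨w, hw⟩ := exists_eval_ne_zero (line_ne_zero_of_smooth hk hq hc hl hS)
    have := LinearMap.congr_fun hst w
    simpa [hl.formDiff_eq_eval, hw] using this

/-- By the product rule `k c - q²` is singular at every common zero of `k, q, c`. -/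
theorem avoids_of_quartic_smooth (hQ : IsSmoothForm 4 (k * c - q ^ 2)) (y : Fin 3 → ℂ)
    (hk0 : eval y k = 0) (hq0 : eval y q = 0) (hc0 : eval y c = 0) : y = 0 := by
  by_contra hy
  rw [isSmoothForm_iff] at hQ
  refine hQ.2 y hy (by simp [hk0, hq0]) (LinearMap.ext fun w => ?_)
  rw [formDiff_discriminant]
  simp [hk0, hq0, hc0]

/-- Otherwise the quartic is the double conic `-q²`, singular at each of its points. -/
theorem bitangent_ne_zero (hq : q.IsHomogeneous 2)
    (hQ : IsSmoothForm 4 (k * c - q ^ 2)) : k ≠ 0 := by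
  rintro rfl
  obtain ⟨y, hy, -, h⟩ := exists_common_zero (isHomogeneous_zero (Fin 3) ℂ 1) hq two_ne_zero
  rw [isSmoothForm_iff] at hQ
  refine hQ.2 y hy (by simp [h]) (LinearMap.ext fun w => ?_)
  rw [formDiff_discriminant]
  simp [h, formDiff_apply]

/-- The line `k = 0` meets the cubic `c = 0`; if `k ∣ q`, all three forms vanish at such a point. -/
theorem not_bitangent_dvd (hk : k.IsHomogeneous 1) (hc : c.IsHomogeneous 3)
    (hQ : IsSmoothForm 4 (k * c - q ^ 2)) : ¬ k ∣ q := by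
  rintro ⟨u, rfl⟩
  obtain ⟨y, hy, h, h'⟩ := exists_common_zero hk hc three_ne_zero
  exact hy (avoids_of_quartic_smooth hQ y h (by simp [h]) h')

/-- The plane section `l = 0` of the cubic surface `x₄ = 0` and this surface are smooth: the
differential of the surface is nowhere a multiple of `l`. -/
theorem surface_ne_smul (hk : k.IsHomogeneous 1)
    (hq : q.IsHomogeneous 2) (hc : c.IsHomogeneous 3) (hl : l.IsHomogeneous 1)
    (hQ : IsSmoothForm 4 (k * c - q ^ 2)) (hT : IsTransverse (k * c - q ^ 2) l)
    {y : Fin 3 → ℂ} {z : ℂ} (hyz : vec5 y z 0 ≠ 0)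
    (h0 : eval (vec5 y z 0) (eckardtCubic k q c l) = 0) {μ : ℂ}
    (hμ : μ * eval y l = 0)
    (hd : ∀ w, formDiff (eckardtCubic k q c l) (vec5 y z 0) w = μ * eval (stdProj w) l) :
    False := by
  rw [isTransverse_iff] at hT
  have hk0 := bitangent_ne_zero hq hQ
  by_cases hy : y = 0
  · subst hy
    have hz : z ≠ 0 := by simpa [vec5_eq_zero_iff] using hyz
    have hkl : ∀ w, eval w k * z ^ 2 = μ * eval w l := by
      intro w
      have := hd (vec5 w 0 0)
      rw [formDiff_eckardtCubic_stdLine _ hk hq hc hl] at this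
      simpa using this
    have hμ0 : μ ≠ 0 := by
      rintro rfl
      exact hk0 (eq_zero_of_eval fun w => by simpa [hz] using hkl w)
    -- At the point `S ∩ ℓ` the hypothesis says that `k` and `l` define the same line. A zero of `q`
    -- on it is a point where the bitangent touches the quartic, since there `dD = c(a) k`; so `l =
    -- 0` is not transverse.
    obtain ⟨a, ha, hka, hqa⟩ := exists_common_zero hk hq two_ne_zero
    have hla : eval a l = 0 := by simpa [hka, hμ0] using hkl a
    refine one_ne_zero (hT a ha (by simp [hka, hqa]) hla 1 (-(eval a c * μ / z ^ 2)) ?_).1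
    refine LinearMap.ext fun w => ?_
    simp only [LinearMap.add_apply, LinearMap.smul_apply, smul_eq_mul, LinearMap.zero_apply,
      formDiff_discriminant, hka, hqa, hk.formDiff_eq_eval, hl.formDiff_eq_eval]
    field_simp
    linear_combination eval a c * hkl w
  -- The `x₃`-direction is invisible to `l`, so its derivative vanishes. Then `c = k z²`, the point
  -- `y` lies on the quartic, and `dD = k(y) μ dl` there: a singular point if `μ = 0`, a tangency
  -- with `l = 0` otherwise.
  · have h3 : eval y k * z + eval y q = 0 := by
      have := hd (vec5 0 1 0)
      rw [formDiff_eckardtCubic] at this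
      simpa [hl.constantCoeff_eq_zero] using this
    have hq0 : eval y q = - eval y k * z := by linear_combination h3
    have hc0 : eval y c = eval y k * z ^ 2 := by
      rw [eval_eckardtCubic] at h0
      simp only [stdProj_vec5, vec5_three, vec5_four] at h0
      rw [hq0] at h0
      linear_combination h0
    have hQ0 : eval y (k * c - q ^ 2) = 0 := by
      simp only [map_sub, map_mul, map_pow, hq0, hc0]; ring
    have hdQ : ∀ w, formDiff (k * c - q ^ 2) y w = eval y k * μ * formDiff l y w := by
      intro w
      have := hd (vec5 w 0 0)
      rw [formDiff_eckardtCubic] at this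
      simp only [stdProj_vec5, vec5_three, vec5_four] at this
      rw [formDiff_discriminant, hq0, hc0, hl.formDiff_eq_eval]
      linear_combination eval y k * this
    by_cases hμ0 : μ = 0
    · rw [isSmoothForm_iff] at hQ
      exact hQ.2 y hy hQ0 (LinearMap.ext fun w => by simp [hdQ, hμ0])
    · refine one_ne_zero (hT y hy hQ0 (by simpa [hμ0] using hμ) 1 (-(eval y k * μ)) ?_).1
      refine LinearMap.ext fun w => ?_
      simp [hdQ]

/-- At a singular point the `x₄`-derivative gives `l(y) t = 0`. Dropping the `x₄`-coordinate then
yields a point of the surface where the differential is `-t² l`, excluded by `surface_ne_smul`,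
unless the point was `p` itself, where `l ≠ 0` suffices. -/
theorem smooth_of_quartic (hk : k.IsHomogeneous 1)
    (hq : q.IsHomogeneous 2) (hc : c.IsHomogeneous 3) (hl : l.IsHomogeneous 1) (hl0 : l ≠ 0)
    (hQ : IsSmoothForm 4 (k * c - q ^ 2)) (hT : IsTransverse (k * c - q ^ 2) l) :
    IsSmoothForm 3 (eckardtCubic k q c l) := by
  rw [isSmoothForm_iff]
  refine ⟨eckardtCubic_isHomogeneous hk hq hc hl, fun v hv h0 hd => ?_⟩
  rw [← vec5_eta v] at hv h0 hd
  set y := stdProj v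
  set z := v 3
  set t := v 4
  have hd' : ∀ w, formDiff (eckardtCubic k q c l) (vec5 y z t) w = 0 := fun w => by rw [hd]; rfl
  have hlt : eval y l * t = 0 := by
    have := hd' (vec5 0 0 1)
    rw [formDiff_eckardtCubic] at this
    simpa using this
  by_cases hv0 : vec5 y z 0 = 0
  · obtain ⟨hy, hz, -⟩ := vec5_eq_zero_iff.mp hv0
    have ht : t ≠ 0 := by rintro h; exact hv (by rw [hy, hz, h, vec5_zero])
    refine hl0 (eq_zero_of_eval fun w => ?_)
    have := hd' (vec5 w 0 0)
    rw [hy, formDiff_eckardtCubic_stdLine _ hk hq hc hl, hz] at this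
    simpa [ht] using this
  · refine surface_ne_smul hk hq hc hl hQ hT hv0 (μ := -t ^ 2) ?_ ?_ fun w => ?_
    · rw [eval_eckardtCubic] at h0 ⊢
      simp only [stdProj_vec5, vec5_three, vec5_four] at h0 ⊢
      linear_combination h0 - t * hlt
    · linear_combination -t * hlt
    · have := hd' w
      rw [formDiff_eckardtCubic] at this ⊢
      simp only [stdProj_vec5, vec5_three, vec5_four, hl.formDiff_eq_eval] at this ⊢
      linear_combination this - 2 * w 4 * hlt

end Discriminant

/-! ### Presentations of the theta characteristic -/

/-- A form whose square lies in the ideal generated by a linear form `k` and `q ^ 2` lies in the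
ideal generated by `k` and `q`. -/
theorem exists_eq_add_of_sq {k q g r s : MvPolynomial (Fin 3) ℂ} (hk : k.IsHomogeneous 1)
    (hk0 : k ≠ 0) (h : g ^ 2 = k * r + q ^ 2 * s) : ∃ a b, g = a * q - b * k := by
  obtain ⟨L, hL⟩ := hk.exists_linear
  have hL0 : L ≠ 0 := by
    rintro rfl
    exact hk0 (eq_zero_of_eval fun v => by simp [hL])
  obtain ⟨j, hj, hr⟩ := exists_basis_ker hL0
  have hLj : ∀ v, eval (j v) k = 0 := fun v => by
    rw [hL]; exact LinearMap.mem_ker.mp (hr ▸ LinearMap.mem_range_self j v)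
  obtain ⟨σ, hσ⟩ := j.exists_leftInverse_of_injective (LinearMap.ker_eq_bot.mpr hj)
  have hσ' : ∀ v, σ (j v) = v := fun v => LinearMap.congr_fun hσ v
  have hpk : pull j k = 0 := eq_zero_of_eval fun v => by simp [hLj]
  -- Restricted to the line `k = 0`, parametrized by `j`, the equation reads `q² ∣ g²`, and
  -- polynomial rings are integrally closed, so `q ∣ g` there.
  have hdvd : pull j q ^ 2 ∣ pull j g ^ 2 :=
    ⟨pull j s, by rw [← map_pow, h, map_add, map_mul, map_mul, hpk, zero_mul, zero_add, map_pow]⟩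
  rw [IsIntegrallyClosed.pow_dvd_pow_iff two_ne_zero] at hdvd
  obtain ⟨w, hw⟩ := hdvd
  -- The retraction `σ` extends the quotient `w` from the line to the plane.
  obtain ⟨b, hb⟩ : k ∣ g - pull σ w * q := by
    refine dvd_of_vanishing hk hk0 fun v hv => ?_
    have hv' : v ∈ LinearMap.range j := by rw [hr, LinearMap.mem_ker, ← hL, hv]
    obtain ⟨u, rfl⟩ := hv'
    have := congrArg (eval u) hw
    simp only [eval_pull, map_mul] at this
    simp only [map_sub, map_mul, eval_pull, hσ', this]
    ring
  exact ⟨pull σ w, -b, by linear_combination hb⟩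

section Presentation

variable {k q c Q m : MvPolynomial (Fin 3) ℂ}

theorem mk_eq_zero_iff (hQ : Associated Q (k * c - q ^ 2)) (x : MvPolynomial (Fin 3) ℂ) :
    Ideal.Quotient.mk (Ideal.span {Q}) x = 0 ↔ k * c - q ^ 2 ∣ x := by
  rw [Ideal.Quotient.eq_zero_iff_mem, Ideal.mem_span_singleton]
  exact hQ.dvd_iff_dvd_left

/-- Modulo the quartic `q² = k c`, so the squares of `q` and `k` are multiples of `k`. Conversely,
if `g²` is a multiple of `m` modulo the quartic, it lies in `(k, q²)`, and `exists_eq_add_of_sq`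
puts `g` into `(k, q)`. -/
theorem thetaIdeal_eq_span (hk : k.IsHomogeneous 1) (hk0 : k ≠ 0)
    (hQ : Associated Q (k * c - q ^ 2)) (hm : Associated m k) :
    thetaIdeal Q m = Ideal.span {Ideal.Quotient.mk (Ideal.span {Q}) q,
      Ideal.Quotient.mk (Ideal.span {Q}) k} := by
  have hmk : Ideal.Quotient.mk (Ideal.span {Q}) m ∣ Ideal.Quotient.mk (Ideal.span {Q}) k :=
    map_dvd _ hm.dvd
  apply le_antisymm
  · refine Ideal.span_le.mpr fun g hg => ?_
    obtain ⟨g, rfl⟩ := Ideal.Quotient.mk_surjective g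
    obtain ⟨r, hr⟩ := hg
    obtain ⟨r, rfl⟩ := Ideal.Quotient.mk_surjective r
    rw [← map_pow, ← map_mul, ← sub_eq_zero, ← map_sub, mk_eq_zero_iff hQ] at hr
    obtain ⟨u, hu⟩ := hr
    obtain ⟨m', rfl⟩ := hm.symm.dvd
    obtain ⟨a, b, rfl⟩ := exists_eq_add_of_sq (g := g) (r := m' * r + c * u) (s := -u) (q := q)
      hk hk0 (by linear_combination hu)
    rw [SetLike.mem_coe, Ideal.mem_span_pair]
    exact ⟨Ideal.Quotient.mk _ a, -Ideal.Quotient.mk _ b, by rw [map_sub, map_mul, map_mul]; ring⟩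
  · rw [Ideal.span_le]
    rintro x (rfl | rfl)
    · refine Ideal.subset_span (hmk.trans ⟨Ideal.Quotient.mk _ c, ?_⟩)
      rw [← map_pow, ← map_mul, ← sub_eq_zero, ← map_sub, mk_eq_zero_iff hQ]
      exact ⟨-1, by ring⟩
    · exact Ideal.subset_span (hmk.trans (dvd_pow_self _ two_ne_zero))

theorem isPresentation_of_associated (hk : k.IsHomogeneous 1) (hq : q.IsHomogeneous 2)
    (hc : c.IsHomogeneous 3) (hk0 : k ≠ 0) (hkq : ¬ k ∣ q) (hD : k * c - q ^ 2 ≠ 0)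
    (hQ : Associated Q (k * c - q ^ 2)) (hm : Associated m k) : IsPresentation Q m k q c := by
  have hθ := thetaIdeal_eq_span hk hk0 hQ hm
  -- The generators `q, -k` pair to zero with the first column of `N` and to `-(k c - q²)` with the
  -- second.
  let ε : (Fin 2 → MvPolynomial (Fin 3) ℂ) →ₗ[MvPolynomial (Fin 3) ℂ] thetaIdeal Q m :=
    { toFun := fun v => ⟨Ideal.Quotient.mk _ (v 0 * q - v 1 * k), by
        rw [hθ, Ideal.mem_span_pair]
        exact ⟨Ideal.Quotient.mk _ (v 0), -Ideal.Quotient.mk _ (v 1), by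
          rw [map_sub, map_mul, map_mul]; ring⟩⟩
      map_add' := fun v w => Subtype.ext (by
        rw [Submodule.coe_add, ← map_add]
        refine congrArg (Ideal.Quotient.mk (Ideal.span {Q})) ?_
        simp only [Pi.add_apply]; ring)
      map_smul' := fun a v => Subtype.ext (by
        change _ = Ideal.Quotient.mk _ (a * (v 0 * q - v 1 * k))
        refine congrArg (Ideal.Quotient.mk (Ideal.span {Q})) ?_
        simp only [Pi.smul_apply, smul_eq_mul]; ring) }
  have hε : ∀ v, (ε v : CoordRing Q) = Ideal.Quotient.mk _ (v 0 * q - v 1 * k) := fun v => rfl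
  have hN : ∀ v, (quadricMatrix k q c).mulVecLin v = ![k * v 0 + q * v 1, q * v 0 + c * v 1] := by
    intro v
    ext1 i
    fin_cases i <;> simp [quadricMatrix, Matrix.mulVec, dotProduct, Fin.sum_univ_two]
  refine ⟨hk, hq, hc, ε, ⟨q, hq, ?_⟩, ⟨-k, hk.neg, ?_⟩, ?_, ?_, ?_⟩
  · rw [hε]; simp
  · rw [hε]; simp
  -- Multiplication by the adjugate of `N`, whose determinant is nonzero.
  · rw [← LinearMap.ker_eq_bot, LinearMap.ker_eq_bot']
    intro v hv
    rw [hN] at hv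
    have h0 : k * v 0 + q * v 1 = 0 := congrFun hv 0
    have h1 : q * v 0 + c * v 1 = 0 := congrFun hv 1
    have e0 : (k * c - q ^ 2) * v 0 = 0 := by linear_combination c * h0 - q * h1
    have e1 : (k * c - q ^ 2) * v 1 = 0 := by linear_combination k * h1 - q * h0
    funext i
    fin_cases i
    · exact (mul_eq_zero.mp e0).resolve_left hD
    · exact (mul_eq_zero.mp e1).resolve_left hD
  · intro v
    rw [← Subtype.coe_inj, hε, Submodule.coe_zero, mk_eq_zero_iff hQ]
    constructor
    · rintro ⟨r, hr⟩
      -- From `v₀ q - v₁ k = (k c - q²) r` the prime `k` divides `(v₀ + r q) q` but not `q`. The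
      -- quotient `w` gives the preimage `(w, -r)`.
      obtain ⟨w, hw⟩ : k ∣ v 0 + r * q := by
        refine ((hk.irreducible_of_one hk0).prime.dvd_or_dvd (a := v 0 + r * q) (b := q) ?_).resolve_right hkq
        exact ⟨v 1 + r * c, by linear_combination hr⟩
      have hw' : v 1 + r * c = q * w :=
        mul_left_cancel₀ hk0 (by linear_combination q * hw - hr)
      refine ⟨![w, -r], ?_⟩
      rw [hN]
      ext1 i
      fin_cases i
      · show k * w + q * -r = v 0
        linear_combination -hw
      · show q * w + c * -r = v 1
        linear_combination -hw'
    · rintro ⟨w, rfl⟩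
      rw [hN]
      refine ⟨-w 1, ?_⟩
      show (k * w 0 + q * w 1) * q - (q * w 0 + c * w 1) * k = _
      ring
  · rintro ⟨x, hx⟩
    rw [hθ, Ideal.mem_span_pair] at hx
    obtain ⟨a, b, rfl⟩ := hx
    obtain ⟨a, rfl⟩ := Ideal.Quotient.mk_surjective a
    obtain ⟨b, rfl⟩ := Ideal.Quotient.mk_surjective b
    refine ⟨![a, -b], Subtype.ext ?_⟩
    rw [hε]
    simp

theorem MvPolynomial.IsHomogeneous.exists_eq_C_mul {n d : ℕ} {P Q : MvPolynomial (Fin n) ℂ}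
    (hQ : Q.IsHomogeneous d) (hP : P.IsHomogeneous d) (h : Q ∣ P) : ∃ a, P = C a * Q := by
  obtain ⟨r, rfl⟩ := h
  by_cases h0 : Q * r = 0
  · exact ⟨0, by simp [h0]⟩
  have e := hP.totalDegree h0
  rw [totalDegree_mul_of_isDomain (left_ne_zero_of_mul h0) (right_ne_zero_of_mul h0),
    hQ.totalDegree (left_ne_zero_of_mul h0)] at e
  exact ⟨_, by rw [mul_comm]; congr 1; exact totalDegree_eq_zero_iff_eq_C.mp (by omega)⟩

theorem MvPolynomial.IsHomogeneous.eq_zero_of_dvd {n d e : ℕ} {P Q : MvPolynomial (Fin n) ℂ}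
    (hQ : Q.IsHomogeneous d) (hP : P.IsHomogeneous e) (hed : e < d) (h : Q ∣ P) : P = 0 := by
  obtain ⟨r, rfl⟩ := h
  by_contra h0
  have e := hP.totalDegree h0
  rw [totalDegree_mul_of_isDomain (left_ne_zero_of_mul h0) (right_ne_zero_of_mul h0),
    hQ.totalDegree (left_ne_zero_of_mul h0)] at e
  omega

theorem formDiff_zero_of_isHomogeneous {n d : ℕ} {P : MvPolynomial (Fin n) ℂ}
    (hP : P.IsHomogeneous d) (hd : 2 ≤ d) : formDiff P 0 = 0 :=
  (formDiff_eq_zero_iff _ _).2 fun i => (hP.pderiv (i := i)).eval_zero (by omega)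

/-- The generators `s, t` of degrees 2 and 1 are determined by degree: surjectivity makes `t`
proportional to `m`, the first column of `N` gives a relation of degree 3, which must hold exactly,
and the second one of degree 4, a constant times `Q`. These relations recover `k` and the
determinant. -/
theorem associated_of_isPresentation (hm : m.IsHomogeneous 1) (hm0 : m ≠ 0)
    (hQ : Q.IsHomogeneous 4) (h : IsPresentation Q m k q c) :
    Associated Q (k * c - q ^ 2) ∧ Associated m k := by
  obtain ⟨hk, hq, hc, ε, ⟨s, hs, hεs⟩, ⟨t, ht, hεt⟩, hinj, hex, hsurj⟩ := h
  have hε : ∀ v, (ε v : CoordRing Q) = Ideal.Quotient.mk (Ideal.span {Q}) (v 0 * s + v 1 * t) := by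
    intro v
    have hv : v = v 0 • Pi.single 0 1 + v 1 • Pi.single 1 1 := by
      ext1 i; fin_cases i <;> simp
    conv_lhs => rw [hv]
    rw [map_add, map_smul, map_smul, Submodule.coe_add, Submodule.coe_smul_of_tower,
      Submodule.coe_smul_of_tower, hεs, hεt]
    rfl
  have hε0 : ∀ v, ε v = 0 ↔ Q ∣ v 0 * s + v 1 * t := by
    intro v
    rw [← Subtype.coe_inj, hε, Submodule.coe_zero, Ideal.Quotient.eq_zero_iff_mem,
      Ideal.mem_span_singleton]
  have hN : ∀ v, (quadricMatrix k q c).mulVecLin v = ![k * v 0 + q * v 1, q * v 0 + c * v 1] := by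
    intro v
    ext1 i
    fin_cases i <;> simp [quadricMatrix, Matrix.mulVec, dotProduct, Fin.sum_univ_two]
  have hrel : ∀ v : Fin 2 → MvPolynomial (Fin 3) ℂ,
      Q ∣ (k * v 0 + q * v 1) * s + (q * v 0 + c * v 1) * t := by
    intro v
    have := (hε0 _).mp ((hex _).mpr ⟨v, rfl⟩)
    rw [hN] at this
    exact this
  have hinj0 : ∀ v, (quadricMatrix k q c).mulVecLin v = 0 → v = 0 := fun v hv =>
    hinj (by rw [hv, map_zero])
  obtain ⟨b, hb⟩ : ∃ b, m = C b * t := by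
    obtain ⟨v, hv⟩ := hsurj ⟨Ideal.Quotient.mk _ m,
      Ideal.subset_span (dvd_pow_self _ two_ne_zero)⟩
    have := congrArg Subtype.val hv
    rw [hε, Ideal.Quotient.eq, Ideal.mem_span_singleton] at this
    obtain ⟨r, hr⟩ := this
    -- Compare linear parts at the origin: `s` and `Q` have none, so only the constant term of `v 1`
    -- contributes.
    refine ⟨eval 0 (v 1), MvPolynomial.funext fun w => ?_⟩
    have := congrArg (fun P => formDiff P 0 w) hr
    simp only [formDiff_sub, formDiff_add, formDiff_mul, hs.eval_zero two_ne_zero,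
      ht.eval_zero one_ne_zero, hQ.eval_zero four_ne_zero,
      formDiff_zero_of_isHomogeneous hs le_rfl,
      formDiff_zero_of_isHomogeneous hQ (by norm_num), LinearMap.zero_apply,
      hm.formDiff_eq_eval, ht.formDiff_eq_eval] at this
    rw [map_mul, eval_C]
    linear_combination -this
  have hb0 : b ≠ 0 := by rintro rfl; exact hm0 (by simp [hb])
  have ht0 : t ≠ 0 := by rintro rfl; exact hm0 (by simp [hb])
  have hmt : Associated m t := associated_iff_C_mul.mpr ⟨b, hb0, hb⟩
  have h1 : k * s + q * t = 0 := by
    refine hQ.eq_zero_of_dvd (e := 3) ((hk.mul hs).add (hq.mul ht)) (by norm_num) ?_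
    simpa using hrel ![1, 0]
  obtain ⟨r, hr⟩ : ∃ r, q * s + c * t = C r * Q := by
    refine hQ.exists_eq_C_mul ((hq.mul hs).add (hc.mul ht)) ?_
    simpa using hrel ![0, 1]
  -- The prime `t` divides `k s`. If `s = t u`, then `(1, -u)` is a relation, hence in the image of
  -- `N`; but the first row of `N` has no constant terms.
  have htk : t ∣ k := by
    refine ((ht.irreducible_of_one ht0).prime.dvd_or_dvd
      (a := k) (b := s) ⟨-q, by linear_combination h1⟩).resolve_right ?_
    rintro ⟨u, hu⟩
    obtain ⟨w, hw⟩ := (hex ![1, -u]).mp ((hε0 _).mpr (by simp [hu, mul_comm]))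
    rw [hN] at hw
    have h0 : k * w 0 + q * w 1 = 1 := congrFun hw 0
    have := congrArg (eval 0) h0
    simp [hk.constantCoeff_eq_zero, hq.constantCoeff_eq_zero] at this
  obtain ⟨a, ha⟩ := ht.exists_eq_C_mul hk htk
  -- Otherwise the first column of `N` is zero.
  have ha0 : a ≠ 0 := by
    rintro rfl
    have hk0 : k = 0 := by simp [ha]
    have hq0 : q = 0 := by simpa [hk0, ht0] using h1
    have := congrFun (hinj0 ![1, 0] (by rw [hN]; ext1 i; fin_cases i <;> simp [hk0, hq0])) 0
    simp at this
  have hqs : q = -(C a * s) :=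
    mul_right_cancel₀ ht0 (by linear_combination h1 - s * ha)
  have hD : k * c - q ^ 2 = C (a * r) * Q := by
    rw [C_mul]
    linear_combination c * ha - q * hqs + C a * hr
  -- If the determinant vanished, `(q, -k)` would be in the kernel of `N`.
  have hD0 : k * c - q ^ 2 ≠ 0 := by
    intro h0
    have := congrFun (hinj0 ![q, -k] (by
      rw [hN]; ext1 i; fin_cases i
      · show k * q + q * -k = 0
        ring
      · show q * q + c * -k = 0
        linear_combination -h0)) 1
    refine ht0 ?_
    have hk0 : k = 0 := by simpa using this
    rw [hk0] at ha
    exact (mul_eq_zero.mp ha.symm).resolve_left (by simpa using ha0)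
  refine ⟨(associated_iff_C_mul.mpr ⟨a * r, ?_, hD⟩).symm,
    hmt.trans (associated_iff_C_mul.mpr ⟨a, ha0, ha⟩).symm⟩
  intro h0
  exact hD0 (by rw [hD, h0, C_0, zero_mul])

end Presentation

/-! ### Involutions and adapted coordinates -/

theorem stdPoint_submodule : stdPoint.submodule = Submodule.span ℂ {vec5 0 0 1} := by
  rw [stdPoint, Projectivization.submodule_mk, single_four]

theorem mem_stdPoint {v : Fin 5 → ℂ} : v ∈ stdPoint.submodule ↔ stdProj v = 0 ∧ v 3 = 0 := by
  rw [stdPoint_submodule, Submodule.mem_span_singleton]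
  constructor
  · rintro ⟨a, rfl⟩
    simp [smul_vec5]
  · rintro ⟨h, h'⟩
    refine ⟨v 4, ?_⟩
    conv_rhs => rw [← vec5_eta v, h, h']
    simp [smul_vec5]

theorem mem_stdLine {v : Fin 5 → ℂ} : v ∈ stdLine ↔ stdProj v = 0 := by
  rw [stdLine, single_three, single_four, Submodule.mem_span_pair]
  constructor
  · rintro ⟨a, b, rfl⟩
    simp [smul_vec5, vec5_add]
  · intro h
    refine ⟨v 3, v 4, ?_⟩
    conv_rhs => rw [← vec5_eta v, h]
    simp [smul_vec5, vec5_add]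

theorem Submodule.map_equiv_eq_of_mem_iff {V : Type*} [AddCommGroup V] [Module ℂ V]
    {S S' : Submodule ℂ V} (g : V ≃ₗ[ℂ] V) (h : ∀ v, g v ∈ S' ↔ v ∈ S) :
    S.map (g : V →ₗ[ℂ] V) = S' := by
  ext v
  rw [Submodule.mem_map_equiv, ← h, LinearEquiv.apply_symm_apply]

theorem Submodule.mem_of_map_equiv_eq {V : Type*} [AddCommGroup V] [Module ℂ V]
    {S S' : Submodule ℂ V} {g : V ≃ₗ[ℂ] V} (h : S.map (g : V →ₗ[ℂ] V) = S') (v : V) :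
    g v ∈ S' ↔ v ∈ S := by
  rw [← h, Submodule.mem_map_equiv, LinearEquiv.symm_apply_apply]

/-- The embedding of the plane by the first three coordinates. -/
def planeEmb : (Fin 3 → ℂ) →ₗ[ℂ] (Fin 5 → ℂ) where
  toFun y := vec5 y 0 0
  map_add' y y' := by simp [vec5_add]
  map_smul' s y := by simp [smul_vec5]

theorem planeEmb_apply (y : Fin 3 → ℂ) : planeEmb y = vec5 y 0 0 := rfl

/-- The linear map with given values on the first three coordinates and on the last two unit
vectors. -/
def assemble (φ : (Fin 3 → ℂ) →ₗ[ℂ] (Fin 5 → ℂ)) (u p : Fin 5 → ℂ) :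
    (Fin 5 → ℂ) →ₗ[ℂ] (Fin 5 → ℂ) :=
  φ ∘ₗ stdProj + (LinearMap.proj 3 : (Fin 5 → ℂ) →ₗ[ℂ] ℂ).smulRight u +
    (LinearMap.proj 4 : (Fin 5 → ℂ) →ₗ[ℂ] ℂ).smulRight p

theorem assemble_apply (φ : (Fin 3 → ℂ) →ₗ[ℂ] (Fin 5 → ℂ)) (u p v : Fin 5 → ℂ) :
    assemble φ u p v = φ (stdProj v) + v 3 • u + v 4 • p := rfl

/-- Interpolation at the four points `0, 1, -1, 2`. -/
theorem cubic_coeff_eq_zero {A B D E K : ℂ} (h : ∀ t : ℂ, A + B * t + D * t ^ 2 + E * t ^ 3 = K) :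
    A = K ∧ B = 0 ∧ D = 0 ∧ E = 0 := by
  have h0 := h 0
  have h1 := h 1
  have h2 := h (-1)
  have h3 := h 2
  refine ⟨by linear_combination h0, ?_, ?_, ?_⟩
  · linear_combination -1 / 2 * h0 + h1 - 1 / 3 * h2 - 1 / 6 * h3
  · linear_combination -h0 + 1 / 2 * h1 + 1 / 2 * h2
  · linear_combination 1 / 2 * h0 - 1 / 2 * h1 - 1 / 6 * h2 + 1 / 6 * h3

/-- A cubic threefold is invariant under a reflection in its Eckardt point. -/
theorem exists_reflection {F : MvPolynomial (Fin 5) ℂ} {p : Projectivization ℂ (Fin 5 → ℂ)}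
    (hF : IsSmoothForm 3 F) (hp : IsEckardtPoint F p) :
    ∃ η : (Fin 5 → ℂ) →ₗ[ℂ] ℂ, η p.rep = 1 ∧ ∀ v, eval (v - (2 * η v) • p.rep) F = eval v F := by
  obtain ⟨hvan, E, φ, -, hφ, hdisj, htan, hE⟩ := hp
  have hpmem : p.rep ∈ p.submodule := by
    rw [Projectivization.submodule_eq]; exact Submodule.mem_span_singleton_self _
  rw [isSmoothForm_iff] at hF
  have hL := hF.2 p.rep p.rep_nonzero (hvan _ hpmem)
  rw [tangentSpace_eq_ker] at htan
  -- A vector transverse to the tangent hyperplane, normalized by `dF_p(u) = 1`. In the coordinates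
  -- `(y, z, t)` for `φ, u, p` the tangent hyperplane is `z = 0`.
  obtain ⟨u, hu⟩ := LinearMap.surjective hL 1
  have hLp : formDiff F p.rep p.rep = 0 :=
    LinearMap.mem_ker.mp (htan ▸ Submodule.mem_sup_left hpmem)
  have hLφ : ∀ y, formDiff F p.rep (φ y) = 0 := fun y =>
    LinearMap.mem_ker.mp (htan ▸ Submodule.mem_sup_right (LinearMap.mem_range_self φ y))
  have hinj : Function.Injective (assemble φ u p.rep) := by
    rw [← LinearMap.ker_eq_bot, LinearMap.ker_eq_bot']
    intro v hv
    rw [assemble_apply] at hv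
    have h3 : v 3 = 0 := by
      have := congrArg (formDiff F p.rep) hv
      simpa [hLφ, hLp, hu] using this
    rw [h3, zero_smul, add_zero] at hv
    have h4 : v 4 • p.rep = 0 := by
      refine Submodule.disjoint_def.mp hdisj _ (Submodule.smul_mem _ _ hpmem) ?_
      exact ⟨-stdProj v, by rw [map_neg]; exact neg_eq_of_add_eq_zero_right hv⟩
    rw [h4, add_zero] at hv
    rw [← vec5_eta v, h3, (smul_eq_zero.mp h4).resolve_right p.rep_nonzero,
      hφ (hv.trans (map_zero φ).symm), vec5_zero]
  let g := LinearEquiv.ofInjectiveEndo _ hinj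
  have hg : ∀ y z t, g (vec5 y z t) = φ y + z • u + t • p.rep := fun y z t => by
    change assemble φ u p.rep _ = _
    rw [assemble_apply]; simp
  obtain ⟨c, b₃, b₄, a₃₃, a₃₄, a₄₄, r₁, r₂, r₃, r₄, hc, h3, -, h33, ha, -, hexp⟩ :=
    exists_cubic_expansion (pull_isHomogeneous (g : (Fin 5 → ℂ) →ₗ[ℂ] (Fin 5 → ℂ)) hF.1)
  -- The cone condition: for `z = 0` the value does not depend on `t`.
  have hplane : ∀ y, _ := fun y => cubic_coeff_eq_zero (A := eval y c) (B := eval y b₄)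
      (D := eval y a₄₄) (E := r₄) (K := eval y E) fun t => by
    have := hexp y 0 t
    rw [eval_pull, LinearEquiv.coe_coe, hg, zero_smul, add_zero,
      hE y _ (Submodule.smul_mem _ _ hpmem)] at this
    linear_combination -this
  -- The coefficient of `z t²` is the derivative at `p` in the direction `u`.
  have hr₃ : r₃ = 1 := by
    have h1 : formDiff (pull (g : (Fin 5 → ℂ) →ₗ[ℂ] (Fin 5 → ℂ)) F) (vec5 0 0 1) (vec5 0 1 0) = 1 := by
      rw [formDiff_comp (F := F) (g : (Fin 5 → ℂ) →ₗ[ℂ] (Fin 5 → ℂ)) (fun v => (eval_pull _ _ _).symm)]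
      rw [LinearEquiv.coe_coe, hg, hg]
      simp [hu]
    have h2 := hasDerivAt_eval_line (pull (g : (Fin 5 → ℂ) →ₗ[ℂ] (Fin 5 → ℂ)) F)
      (vec5 0 0 1) (vec5 0 1 0)
    rw [h1] at h2
    have hs : ∀ s : ℂ, eval (vec5 0 0 1 + s • vec5 0 1 0)
        (pull (g : (Fin 5 → ℂ) →ₗ[ℂ] (Fin 5 → ℂ)) F) = r₁ * s ^ 3 + r₂ * s ^ 2 + r₃ * s := by
      intro s
      have hc0 := hc.eval_zero three_ne_zero
      rw [(hplane 0).1] at hc0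
      simp only [smul_vec5, vec5_add, hexp, hplane, smul_zero, add_zero, hc0,
        h3.eval_zero two_ne_zero, h33.eval_zero one_ne_zero, ha.eval_zero one_ne_zero,
        (hplane 0).2.2.2]
      ring
    simp only [hs] at h2
    have hid := hasDerivAt_id (0 : ℂ)
    have := (((hid.pow 3).const_mul r₁).add ((hid.pow 2).const_mul r₂)).add (hid.const_mul r₃)
    simpa using (h2.unique this).symm
  -- The terms involving `t` are now `z (t² + (a₃₄ + r₂ z) t)`. Completing the square gives `η`, and
  -- the reflection changes its sign.
  let η : (Fin 5 → ℂ) →ₗ[ℂ] ℂ := LinearMap.proj 4 +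
    (2⁻¹ : ℂ) • (formDiff a₃₄ 0 ∘ₗ stdProj + r₂ • LinearMap.proj 3)
  have hη : ∀ v, η v = v 4 + 2⁻¹ * (eval (stdProj v) a₃₄ + r₂ * v 3) := fun v => by
    rw [← ha.formDiff_eq_eval 0]; rfl
  have hg4 : g (vec5 0 0 1) = p.rep := by rw [hg]; simp
  refine ⟨η ∘ₗ (g.symm : (Fin 5 → ℂ) →ₗ[ℂ] (Fin 5 → ℂ)), ?_, fun v => ?_⟩
  · rw [LinearMap.comp_apply, LinearEquiv.coe_coe, ← hg4, g.symm_apply_apply, hη]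
    simp [ha.constantCoeff_eq_zero]
  · obtain ⟨w, rfl⟩ := g.surjective v
    rw [LinearMap.comp_apply, LinearEquiv.coe_coe, g.symm_apply_apply, ← hg4, ← map_smul,
      ← map_sub]
    have hpull : ∀ x, eval (g x) F = eval x (pull (g : (Fin 5 → ℂ) →ₗ[ℂ] (Fin 5 → ℂ)) F) :=
      fun x => by rw [eval_pull]; rfl
    rw [hpull, hpull, hη, ← vec5_eta w, sub_eq_add_neg, ← neg_smul, smul_vec5, vec5_add, hexp, hexp]
    simp only [stdProj_vec5, vec5_three, vec5_four, smul_zero, add_zero, mul_zero, hplane,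
      (hplane 0).2.2.2, hr₃]
    ring

theorem isFixedHyperplane_ker {F : MvPolynomial (Fin 5) ℂ} {p : Projectivization ℂ (Fin 5 → ℂ)}
    {p₀ : Fin 5 → ℂ} (hp : p.submodule = Submodule.span ℂ {p₀}) {η : (Fin 5 → ℂ) →ₗ[ℂ] ℂ}
    (h1 : η p₀ = 1) (hη : ∀ v, eval (v - (2 * η v) • p₀) F = eval v F) :
    IsFixedHyperplane F p (LinearMap.ker η) := by
  refine ⟨⟨?_, ?_⟩, LinearMap.id - (2 : ℂ) • η.smulRight p₀, fun v hv => ?_, fun v hv => ?_,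
    fun v => ?_⟩
  · rw [hp, Submodule.disjoint_def]
    intro x hx hx'
    obtain ⟨a, rfl⟩ := Submodule.mem_span_singleton.mp hx'
    have : a = 0 := by simpa [h1] using hx
    simp [this]
  · rw [codisjoint_iff, eq_top_iff, hp]
    intro v _
    rw [Submodule.mem_sup]
    exact ⟨v - η v • p₀, by simp [h1], η v • p₀,
      Submodule.smul_mem _ _ (Submodule.mem_span_singleton_self _), by simp⟩
  · simp [LinearMap.mem_ker.mp hv]
  · rw [hp] at hv
    obtain ⟨a, rfl⟩ := Submodule.mem_span_singleton.mp hv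
    simp [h1, two_smul]
  · rw [← hη v]
    simp [smul_smul]

section Coordinates

variable {F : MvPolynomial (Fin 5) ℂ} {p : Projectivization ℂ (Fin 5 → ℂ)}
  {e : (Fin 5 → ℂ) ≃ₗ[ℂ] (Fin 5 → ℂ)} {k q c l : MvPolynomial (Fin 3) ℂ}

/-- The last coordinate. -/
def lastCoord (e : (Fin 5 → ℂ) ≃ₗ[ℂ] (Fin 5 → ℂ)) : (Fin 5 → ℂ) →ₗ[ℂ] ℂ :=
  LinearMap.proj 4 ∘ₗ (e : (Fin 5 → ℂ) →ₗ[ℂ] (Fin 5 → ℂ))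

theorem lastCoord_apply (v : Fin 5 → ℂ) : lastCoord e v = e v 4 := rfl

theorem submodule_eq_span_of_map
    (hp : p.submodule.map (e : (Fin 5 → ℂ) →ₗ[ℂ] (Fin 5 → ℂ)) = stdPoint.submodule) :
    p.submodule = Submodule.span ℂ {e.symm (vec5 0 0 1)} := by
  ext v
  rw [← Submodule.mem_of_map_equiv_eq hp, stdPoint_submodule, Submodule.mem_span_singleton,
    Submodule.mem_span_singleton]
  refine exists_congr fun a => ?_
  rw [← map_smul, LinearEquiv.symm_apply_eq]

/-- In adapted coordinates the fixed hyperplane is `x₄ = 0`. -/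
theorem isFixedHyperplane_iff
    (hp : p.submodule.map (e : (Fin 5 → ℂ) →ₗ[ℂ] (Fin 5 → ℂ)) = stdPoint.submodule)
    (hF : ∀ v, eval v F = eval (e v) (eckardtCubic k q c l)) (hl : l.IsHomogeneous 1)
    (hl0 : l ≠ 0) (H : Submodule ℂ (Fin 5 → ℂ)) :
    IsFixedHyperplane F p H ↔ H = LinearMap.ker (lastCoord e) := by
  have hspan := submodule_eq_span_of_map hp
  constructor
  · rintro ⟨hc, τ, hτH, hτp, hτ⟩
    set p₀ := e.symm (vec5 0 0 1)
    have hep : e p₀ = vec5 0 0 1 := e.apply_symm_apply _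
    have hpmem : p₀ ∈ p.submodule := hspan ▸ Submodule.mem_span_singleton_self _
    have hdec : ∀ v, ∃ h ∈ H, ∃ s : ℂ, v = h + s • p₀ := by
      intro v
      have : v ∈ H ⊔ p.submodule := hc.sup_eq_top ▸ Submodule.mem_top
      rw [hspan] at this
      obtain ⟨h, hh, x, hx, rfl⟩ := Submodule.mem_sup.mp this
      obtain ⟨s, rfl⟩ := Submodule.mem_span_singleton.mp hx
      exact ⟨h, hh, s, rfl⟩
    -- Invariance means equal values at `h + p₀` and `h - p₀`, which differ by `4 l x₄`.
    have hz : ∀ h ∈ H, eval (stdProj (e h)) l * e h 4 = 0 := by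
      intro h hh
      have := hτ (h + p₀)
      rw [map_add, hτH h hh, hτp p₀ hpmem, hF, hF, map_add, map_add, map_neg, hep,
        ← vec5_eta (e h), ← neg_one_smul ℂ, smul_vec5, vec5_add, vec5_add, eval_eckardtCubic,
        eval_eckardtCubic] at this
      simp only [stdProj_vec5, vec5_three, vec5_four, smul_zero, add_zero, mul_zero] at this
      linear_combination -this / 4
    -- On `H` the product `l x₄` of linear functions vanishes. As `H` contains an `h₀` with `l ≠ 0`,
    -- where `x₄` is therefore zero, translating by `h₀` shows that `x₄` vanishes on all of `H`.
    obtain ⟨y, hy⟩ := exists_eval_ne_zero hl0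
    obtain ⟨h₀, hh₀, s, hs⟩ := hdec (e.symm (vec5 y 0 0))
    have hy₀ : stdProj (e h₀) = y := by
      have := congrArg (fun v => stdProj (e v)) hs
      simpa [hep] using this.symm
    obtain ⟨L, hL⟩ := hl.exists_linear
    have h40 : e h₀ 4 = 0 := by simpa [hy₀, hy] using hz h₀ hh₀
    have hle : ∀ h ∈ H, e h 4 = 0 := by
      intro h hh
      have h1 := hz h hh
      have h2 := hz (h + h₀) (H.add_mem hh hh₀)
      rw [map_add, map_add, hL, map_add, ← hL, ← hL, hy₀, Pi.add_apply, h40, add_zero, add_mul,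
        h1, zero_add] at h2
      exact (mul_eq_zero.mp h2).resolve_left hy
    ext v
    rw [LinearMap.mem_ker, lastCoord_apply]
    refine ⟨hle v, fun hv => ?_⟩
    obtain ⟨h, hh, s, rfl⟩ := hdec v
    have : s = 0 := by simpa [hep, hle h hh] using hv
    simpa [this] using hh
  · rintro rfl
    refine isFixedHyperplane_ker hspan (by simp [lastCoord_apply]) fun v => ?_
    rw [hF, hF, map_sub, map_smul, e.apply_symm_apply, lastCoord_apply, eval_eckardtCubic,
      eval_eckardtCubic, map_sub, map_smul, stdProj_vec5]
    simp only [Pi.sub_apply, Pi.smul_apply, vec5_three, vec5_four, smul_zero, sub_zero, smul_eq_mul]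
    ring

end Coordinates

/-- Adapted coordinates exist. -/
theorem exists_isAdapted (T : EckardtTriple) : ∃ e k q c l, IsAdapted T e k q c l := by
  obtain ⟨F, p, ℓ, hT⟩ := T
  obtain ⟨η, hη1, hη⟩ := exists_reflection hT.smooth hT.eckardt
  have hpmem : p.rep ∈ p.submodule := by
    rw [Projectivization.submodule_eq]; exact Submodule.mem_span_singleton_self _
  have hpℓ := hT.mem_line hpmem
  have hℓ : Module.finrank ℂ ℓ = 2 := hT.isLine
  -- The vector `u` represents the point of `ℓ` on the mirror `η = 0`.
  obtain ⟨u, hu, hηu, hu0⟩ : ∃ u ∈ ℓ, η u = 0 ∧ u ≠ 0 := by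
    have hne : ¬ ℓ ≤ p.submodule := by
      intro hle
      have := Submodule.finrank_mono hle
      rw [hℓ, Projectivization.finrank_submodule] at this
      omega
    obtain ⟨x, hx, hxp⟩ := SetLike.not_le_iff_exists.mp hne
    refine ⟨x - η x • p.rep, ℓ.sub_mem hx (ℓ.smul_mem _ hpℓ), by simp [hη1], fun h => hxp ?_⟩
    rw [sub_eq_zero.mp h]
    exact Submodule.smul_mem _ _ hpmem
  obtain ⟨W, hW⟩ := Submodule.exists_isCompl ℓ
  have hWf : Module.finrank ℂ W = 3 := by
    have := Submodule.finrank_add_eq_of_isCompl hW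
    simp at this; omega
  let ψ : (Fin 3 → ℂ) ≃ₗ[ℂ] W := LinearEquiv.ofFinrankEq _ _ (by simp [hWf])
  let ψ' : (Fin 3 → ℂ) →ₗ[ℂ] (Fin 5 → ℂ) := W.subtype ∘ₗ (ψ : (Fin 3 → ℂ) →ₗ[ℂ] W)
  -- Moves a complement of `ℓ` into the mirror along `p`; it remains a complement because `p` lies
  -- on `ℓ`.
  let φ : (Fin 3 → ℂ) →ₗ[ℂ] (Fin 5 → ℂ) := ψ' - (η ∘ₗ ψ').smulRight p.rep
  have hφ : ∀ y, φ y = (ψ y : Fin 5 → ℂ) - η (ψ y) • p.rep := fun y => rfl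
  have hηφ : ∀ y, η (φ y) = 0 := fun y => by rw [hφ]; simp [hη1]
  have hφℓ : ∀ y, φ y ∈ ℓ → y = 0 := by
    intro y hy
    have h1 : (ψ y : Fin 5 → ℂ) ∈ ℓ := by
      have := ℓ.add_mem hy (ℓ.smul_mem (η (ψ y)) hpℓ)
      rwa [hφ, sub_add_cancel] at this
    have := Submodule.disjoint_def.mp hW.disjoint _ h1 (ψ y).2
    exact ψ.map_eq_zero_iff.mp (Subtype.ext this)
  have hinj : Function.Injective (assemble φ u p.rep) := by
    rw [← LinearMap.ker_eq_bot, LinearMap.ker_eq_bot']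
    intro v hv
    rw [assemble_apply] at hv
    have h4 : v 4 = 0 := by simpa [hηφ, hηu, hη1] using congrArg η hv
    have hy : stdProj v = 0 := by
      apply hφℓ
      have : φ (stdProj v) = -(v 3 • u) := by
        rw [h4, zero_smul, add_zero] at hv
        exact eq_neg_of_add_eq_zero_left hv
      rw [this]
      exact ℓ.neg_mem (ℓ.smul_mem _ hu)
    rw [hy, h4, map_zero, zero_smul, zero_add, add_zero] at hv
    rw [← vec5_eta v, hy, h4, (smul_eq_zero.mp hv).resolve_right hu0, vec5_zero]
  let g := LinearEquiv.ofInjectiveEndo _ hinj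
  have hg : ∀ y z t, g (vec5 y z t) = φ y + z • u + t • p.rep := fun y z t => by
    change assemble φ u p.rep _ = _
    rw [assemble_apply]; simp
  have hmem : ∀ v, g v ∈ ℓ ↔ stdProj v = 0 := by
    intro v
    rw [← vec5_eta v, hg, stdProj_vec5, ℓ.add_mem_iff_left (ℓ.smul_mem _ hpℓ),
      ℓ.add_mem_iff_left (ℓ.smul_mem _ hu)]
    exact ⟨hφℓ _, fun h => by rw [h, map_zero]; exact ℓ.zero_mem⟩
  obtain ⟨c, b₃, b₄, a₃₃, a₃₄, a₄₄, r₁, r₂, r₃, r₄, hc, hb₃, -, ha₃₃, -, ha₄₄, hexp⟩ :=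
    exists_cubic_expansion (pull_isHomogeneous (g : (Fin 5 → ℂ) →ₗ[ℂ] (Fin 5 → ℂ)) hT.smooth.1)
  simp only [eval_pull, LinearEquiv.coe_coe] at hexp
  have heven : ∀ y z t, eval (g (vec5 y z (-t))) F = eval (g (vec5 y z t)) F := by
    intro y z t
    rw [← hη (g (vec5 y z t))]
    congr 2
    simp only [hg, map_add, map_smul, hηφ, hηu, hη1]
    simp only [zero_add, smul_eq_mul, mul_one]
    module
  have hline : ∀ z t, eval (g (vec5 0 z t)) F = 0 := fun z t =>
    hT.line_le _ ((hmem _).mpr (stdProj_vec5 _ _ _))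
  -- The pure terms in `z, t` that are even in `t` vanish because `ℓ` lies on the cubic; the odd
  -- ones need no treatment, since averaging over `t ↦ -t` removes them at the end.
  have hr₁ : r₁ = 0 := by
    have := hexp 0 1 0
    rw [hline] at this
    simpa [hc.constantCoeff_eq_zero, hb₃.constantCoeff_eq_zero, ha₃₃.constantCoeff_eq_zero]
      using this.symm
  have hr₃ : r₃ = 0 := by
    have h1 := hexp 0 1 1
    have h2 := hexp 0 1 (-1)
    rw [hline] at h1 h2
    have := congrArg₂ (· + ·) h1 h2
    simp only [hc.eval_zero three_ne_zero, hb₃.eval_zero two_ne_zero, ha₃₃.eval_zero one_ne_zero,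
      ha₄₄.eval_zero one_ne_zero, hr₁] at this
    linear_combination -this / 2
  refine ⟨g.symm, a₃₃, C (1 / 2) * b₃, c, a₄₄, ha₃₃, hb₃.C_mul _, hc, ha₄₄, ?_, ?_, fun v => ?_⟩
  · refine Submodule.map_equiv_eq_of_mem_iff _ fun v => ?_
    obtain ⟨v, rfl⟩ := g.surjective v
    rw [g.symm_apply_apply, stdPoint_submodule, Projectivization.submodule_eq,
      Submodule.mem_span_singleton, Submodule.mem_span_singleton]
    refine exists_congr fun a => ?_
    have : g (vec5 0 0 1) = p.rep := by rw [hg]; simp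
    rw [← this, ← map_smul, g.injective.eq_iff]
  · refine Submodule.map_equiv_eq_of_mem_iff _ fun v => ?_
    obtain ⟨v, rfl⟩ := g.surjective v
    rw [g.symm_apply_apply, mem_stdLine]
    exact (hmem v).symm
  · obtain ⟨v, rfl⟩ := g.surjective v
    rw [g.symm_apply_apply]
    have h1 := heven (stdProj v) (v 3) (v 4)
    have h2 := hexp (stdProj v) (v 3) (v 4)
    have h3 := hexp (stdProj v) (v 3) (-v 4)
    rw [vec5_eta] at h1 h2
    rw [eval_eckardtCubic, map_mul, eval_C]
    change eval (g v) F = _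
    rw [hr₁, hr₃] at h2 h3
    linear_combination (h2 + h3 - h1) / 2

/-! ### Eckardt triples and quartic triples -/

theorem isLine_span_pair {n : ℕ} {a b : Fin n → ℂ} (h : ∀ s t : ℂ, s • a + t • b = 0 → s = 0 ∧ t = 0) :
    IsLine (Submodule.span ℂ {a, b}) := by
  have hli : LinearIndependent ℂ ![a, b] := LinearIndependent.pair_iff.mpr h
  have := finrank_span_eq_card hli
  rwa [Matrix.range_cons, Matrix.range_cons, Matrix.range_empty, Set.union_empty,
    Set.singleton_union, Fintype.card_fin] at this

theorem IsSmoothForm.of_associated {n d : ℕ} {F G : MvPolynomial (Fin n) ℂ}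
    (hF : IsSmoothForm d F) (h : Associated G F) : IsSmoothForm d G := by
  obtain ⟨a, ha, rfl⟩ := associated_iff_C_mul.mp h
  rw [isSmoothForm_iff] at hF ⊢
  refine ⟨hF.1.C_mul a, fun v hv h0 hd => hF.2 v hv (by simpa [ha] using h0) ?_⟩
  rw [formDiff_smul_form] at hd
  exact (smul_eq_zero.mp hd).resolve_left ha

theorem IsTransverse.of_associated {Q D l : MvPolynomial (Fin 3) ℂ}
    (hD : IsTransverse D l) (h : Associated Q D) : IsTransverse Q l := by
  obtain ⟨a, ha, rfl⟩ := associated_iff_C_mul.mp h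
  rw [isTransverse_iff] at hD ⊢
  intro y hy h0 hl s t hst
  rw [formDiff_smul_form, smul_smul] at hst
  obtain ⟨h1, h2⟩ := hD y hy (by simpa [ha] using h0) hl _ _ hst
  exact ⟨(mul_eq_zero.mp h1).resolve_right ha, h2⟩

section Triples

variable {k q c l : MvPolynomial (Fin 3) ℂ}

/-- If `Q = a (k c - q²)` and `r² = -a`, then `Q - (r q)² = a k c`. -/
theorem isBitangent_of_associated {Q m : MvPolynomial (Fin 3) ℂ} (hk : k.IsHomogeneous 1)
    (hq : q.IsHomogeneous 2) (hk0 : k ≠ 0)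
    (hQ : Associated Q (k * c - q ^ 2)) (hm : Associated m k) : IsBitangent Q m := by
  obtain ⟨a, ha, rfl⟩ := associated_iff_C_mul.mp hQ
  obtain ⟨b, hb, rfl⟩ := associated_iff_C_mul.mp hm
  obtain ⟨r, hr⟩ := IsAlgClosed.exists_pow_nat_eq (-a) two_pos
  refine ⟨hk.C_mul b, mul_ne_zero (by simpa using hb) hk0, C r * q, hq.C_mul r,
    hm.dvd.trans ⟨C a * c, ?_⟩⟩
  have : (C r : MvPolynomial (Fin 3) ℂ) ^ 2 = -C a := by rw [← C_pow, hr, C_neg]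
  linear_combination -q ^ 2 * this

/-- Over a common zero `y` the polynomial `k z² + 2 q z + c` is identically zero, so `S` contains
the line joining `y` to the point `S ∩ ℓ`, which `ℓ` was assumed to avoid. -/
theorem bitangent_conic_cubic_disjoint {F : MvPolynomial (Fin 5) ℂ}
    {p : Projectivization ℂ (Fin 5 → ℂ)} {ℓ : Submodule ℂ (Fin 5 → ℂ)}
    {e : (Fin 5 → ℂ) ≃ₗ[ℂ] (Fin 5 → ℂ)}
    (hT : IsEckardtTriple F p ℓ)
    (hp : p.submodule.map (e : (Fin 5 → ℂ) →ₗ[ℂ] (Fin 5 → ℂ)) = stdPoint.submodule)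
    (hℓ : ℓ.map (e : (Fin 5 → ℂ) →ₗ[ℂ] (Fin 5 → ℂ)) = stdLine)
    (hF : ∀ v, eval v F = eval (e v) (eckardtCubic k q c l)) (hk : k.IsHomogeneous 1)
    (hq : q.IsHomogeneous 2) (hc : c.IsHomogeneous 3) (hl : l.IsHomogeneous 1) (hl0 : l ≠ 0)
    (y : Fin 3 → ℂ) (hky : eval y k = 0) (hqy : eval y q = 0) (hcy : eval y c = 0) : y = 0 := by
  by_contra hy
  have hcomb : ∀ s t : ℂ, e (s • e.symm (vec5 y 0 0) + t • e.symm (vec5 0 1 0)) =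
      vec5 (s • y) t 0 := by
    intro s t
    simp [smul_vec5, vec5_add]
  have hd := hT.avoids _ ((isFixedHyperplane_iff hp hF hl hl0 _).mpr rfl)
    (Submodule.span ℂ {e.symm (vec5 y 0 0), e.symm (vec5 0 1 0)}) ?_ ?_ ?_
  · have hb : e.symm (vec5 0 1 0) ∈ ℓ := by
      rw [← Submodule.mem_of_map_equiv_eq hℓ, e.apply_symm_apply, mem_stdLine, stdProj_vec5]
    have := Submodule.disjoint_def.mp hd _ hb
      (Submodule.subset_span (Set.mem_insert_of_mem _ rfl))
    rw [LinearEquiv.map_eq_zero_iff, vec5_eq_zero_iff] at this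
    exact one_ne_zero this.2.1
  · refine isLine_span_pair fun s t h => ?_
    have := congrArg e h
    rw [hcomb, map_zero, vec5_eq_zero_iff] at this
    exact ⟨(smul_eq_zero.mp this.1).resolve_right hy, this.2.1⟩
  · intro v hv
    obtain ⟨s, t, rfl⟩ := Submodule.mem_span_pair.mp hv
    rw [LinearMap.mem_ker, lastCoord_apply, hcomb, vec5_four]
  · intro v hv
    obtain ⟨s, t, rfl⟩ := Submodule.mem_span_pair.mp hv
    rw [hF, hcomb, eval_eckardtCubic, stdProj_vec5, hk.eval_smul, hq.eval_smul, hc.eval_smul, hky,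
      hqy, hcy, vec5_four]
    ring

theorem IsAdapted.smooth {T : EckardtTriple} {e : (Fin 5 → ℂ) ≃ₗ[ℂ] (Fin 5 → ℂ)}
    (h : IsAdapted T e k q c l) : IsSmoothForm 3 (eckardtCubic k q c l) :=
  isSmoothForm_of_equiv e h.equation T.isTriple.smooth

theorem IsAdapted.line_ne_zero {T : EckardtTriple} {e : (Fin 5 → ℂ) ≃ₗ[ℂ] (Fin 5 → ℂ)}
    (h : IsAdapted T e k q c l) : l ≠ 0 :=
  line_ne_zero_of_smooth h.hk h.hq h.hc h.hl h.smooth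

theorem isQuarticTriple_of_smooth (hk : k.IsHomogeneous 1)
    (hq : q.IsHomogeneous 2) (hc : c.IsHomogeneous 3) (hl : l.IsHomogeneous 1)
    (hS : IsSmoothForm 3 (eckardtCubic k q c l))
    (hav : ∀ y, eval y k = 0 → eval y q = 0 → eval y c = 0 → y = 0)
    {Q m : MvPolynomial (Fin 3) ℂ}
    (hQ : Associated Q (k * c - q ^ 2)) (hm : Associated m k) : IsQuarticTriple Q m l := by
  obtain ⟨h1, h2⟩ := quartic_of_smooth hk hq hc hl hS hav
  exact ⟨h1.of_associated hQ,
    isBitangent_of_associated hk hq (bitangent_ne_zero hq h1) hQ hm, hl,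
    line_ne_zero_of_smooth hk hq hc hl hS, h2.of_associated hQ⟩

theorem isPresentation_of_smooth (hk : k.IsHomogeneous 1)
    (hq : q.IsHomogeneous 2) (hc : c.IsHomogeneous 3) (h : IsSmoothForm 4 (k * c - q ^ 2))
    {Q m : MvPolynomial (Fin 3) ℂ}
    (hQ : Associated Q (k * c - q ^ 2)) (hm : Associated m k) : IsPresentation Q m k q c := by
  have hk0 := bitangent_ne_zero hq h
  have hkq := not_bitangent_dvd hk hc h
  refine isPresentation_of_associated hk hq hc hk0 hkq (fun h0 => hkq ?_) hQ hm
  exact (hk.irreducible_of_one hk0).prime.dvd_of_dvd_pow ⟨c, (sub_eq_zero.mp h0).symm⟩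

/-- The tangent hyperplane at `p` is `l = 0`, and on it `x₄` drops out of the equation: the section
is a cone over the plane cubic `k z² + 2 q z + c = 0` in `l = x₄ = 0`. A singular point of this
cubic is a point of `S` where the differential is a multiple of `l`, excluded by `surface_ne_smul`.
-/
theorem isEckardtPoint_stdPoint (hk : k.IsHomogeneous 1)
    (hq : q.IsHomogeneous 2) (hc : c.IsHomogeneous 3) (hl : l.IsHomogeneous 1) (hl0 : l ≠ 0)
    (hQ : IsSmoothForm 4 (k * c - q ^ 2)) (hT : IsTransverse (k * c - q ^ 2) l) :
    IsEckardtPoint (eckardtCubic k q c l) stdPoint := by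
  have hhom := eckardtCubic_isHomogeneous hk hq hc hl
  obtain ⟨L, hL⟩ := hl.exists_linear
  have hL0 : L ≠ 0 := by
    rintro rfl
    exact hl0 (eq_zero_of_eval fun v => by simp [hL])
  obtain ⟨j, hj, hr⟩ := exists_basis_ker hL0
  let φ : (Fin 3 → ℂ) →ₗ[ℂ] (Fin 5 → ℂ) :=
    planeEmb ∘ₗ j ∘ₗ LinearMap.funLeft ℂ ℂ Fin.castSucc +
      (LinearMap.proj 2 : (Fin 3 → ℂ) →ₗ[ℂ] ℂ).smulRight (vec5 0 1 0)
  have hφ : ∀ a, φ a = vec5 (j (a ∘ Fin.castSucc)) (a 2) 0 := by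
    intro a
    change planeEmb (j (a ∘ Fin.castSucc)) + a 2 • vec5 0 1 0 = _
    simp [planeEmb_apply, smul_vec5, vec5_add]
  have hlφ : ∀ a : Fin 3 → ℂ, eval (j (a ∘ Fin.castSucc)) l = 0 := fun a => by
    rw [hL]; exact LinearMap.mem_ker.mp (hr ▸ LinearMap.mem_range_self j _)
  have hrange : ∀ y z, eval y l = 0 → ∃ a, φ a = vec5 y z 0 := by
    intro y z hy
    have : y ∈ LinearMap.range j := by rw [hr, LinearMap.mem_ker, ← hL, hy]
    obtain ⟨b, rfl⟩ := this
    refine ⟨![b 0, b 1, z], ?_⟩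
    rw [hφ]
    congr 2
    ext i; fin_cases i <;> rfl
  have hinj : Function.Injective φ := by
    rw [← LinearMap.ker_eq_bot, LinearMap.ker_eq_bot']
    intro a ha
    rw [hφ, vec5_eq_zero_iff] at ha
    have h0 : a ∘ Fin.castSucc = 0 := hj (ha.1.trans (map_zero j).symm)
    ext i
    fin_cases i
    exacts [congrFun h0 0, congrFun h0 1, ha.2.1]
  refine ⟨fun v hv => ?_, pull φ (eckardtCubic k q c l), φ, ?_, hinj, ?_, ?_, ?_⟩
  · obtain ⟨h1, h2⟩ := mem_stdPoint.mp hv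
    rw [← vec5_eta v, h1, eval_eckardtCubic_stdLine hk hq hc hl]
  · rw [isSmoothForm_iff]
    refine ⟨pull_isHomogeneous φ hhom, fun a ha h0 hd => ?_⟩
    rw [eval_pull, hφ] at h0
    have hd' : ∀ b, formDiff (eckardtCubic k q c l) (φ a) (φ b) = 0 := fun b => by
      rw [← formDiff_comp φ (fun v => (eval_pull φ _ v).symm), hd]; rfl
    -- The differential kills the plane and the direction of `p`, hence is a multiple of `l`; its
    -- value on a vector with `l = 1` is the factor.
    obtain ⟨y₁, hy₁⟩ := LinearMap.surjective hL0 1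
    refine surface_ne_smul hk hq hc hl hQ hT (fun h => ha (hinj ?_)) h0
      (μ := formDiff (eckardtCubic k q c l) (φ a) (vec5 y₁ 0 0)) ?_ fun w => ?_
    · rw [hφ, h, map_zero]
    · rw [hlφ, mul_zero]
    · obtain ⟨b, hb⟩ := hrange (stdProj w - L (stdProj w) • y₁) (w 3) (by
        rw [hL, map_sub, map_smul, hy₁]; simp)
      have hw : w = φ b + L (stdProj w) • vec5 y₁ 0 0 + w 4 • vec5 0 0 1 := by
        rw [hb, smul_vec5, smul_vec5, vec5_add, vec5_add]
        conv_lhs => rw [← vec5_eta w]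
        simp
      have h4 : formDiff (eckardtCubic k q c l) (φ a) (vec5 0 0 1) = 0 := by
        rw [hφ, formDiff_eckardtCubic]; simp
      conv_lhs => rw [hw]
      rw [← hφ, map_add, map_add, map_smul, map_smul, hd', h4, hL]
      simp [mul_comm]
  · rw [Submodule.disjoint_def]
    rintro _ hx ⟨a, rfl⟩
    obtain ⟨h1, h2⟩ := mem_stdPoint.mp hx
    rw [← vec5_eta (φ a), h1, h2, hφ, vec5_four, vec5_zero]
  · have hmem : stdPoint.rep ∈ stdPoint.submodule := by
      rw [Projectivization.submodule_eq]; exact Submodule.mem_span_singleton_self _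
    obtain ⟨h1, h2⟩ := mem_stdPoint.mp hmem
    have hrep : stdPoint.rep = vec5 0 0 (stdPoint.rep 4) := by
      conv_lhs => rw [← vec5_eta stdPoint.rep, h1, h2]
    have hne : stdPoint.rep 4 ≠ 0 := fun h => stdPoint.rep_nonzero (by rw [hrep, h, vec5_zero])
    ext v
    rw [tangentSpace_eq_ker, LinearMap.mem_ker, hrep,
      formDiff_eckardtCubic_stdLine v hk hq hc hl, Submodule.mem_sup]
    constructor
    · rintro ⟨x, hx, _, ⟨a, rfl⟩, rfl⟩
      rw [map_add, (mem_stdPoint.mp hx).1, hφ, stdProj_vec5, zero_add, hlφ]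
      ring
    · intro h
      obtain ⟨a, ha⟩ := hrange (stdProj v) (v 3) (by simpa [hne] using h)
      refine ⟨vec5 0 0 (v 4), mem_stdPoint.mpr (by simp), φ a, ⟨a, rfl⟩, ?_⟩
      rw [ha, vec5_add]
      conv_rhs => rw [← vec5_eta v]
      simp
  · intro y v hv
    obtain ⟨h1, h2⟩ := mem_stdPoint.mp hv
    rw [eval_pull, hφ, ← vec5_eta v, h1, h2, vec5_add, eval_eckardtCubic, eval_eckardtCubic]
    simp [hlφ]

theorem isEckardtTriple_of_quartic (hk : k.IsHomogeneous 1)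
    (hq : q.IsHomogeneous 2) (hc : c.IsHomogeneous 3) (hl : l.IsHomogeneous 1) (hl0 : l ≠ 0)
    (hQ : IsSmoothForm 4 (k * c - q ^ 2)) (hT : IsTransverse (k * c - q ^ 2) l) :
    IsEckardtTriple (eckardtCubic k q c l) stdPoint stdLine where
  smooth := smooth_of_quartic hk hq hc hl hl0 hQ hT
  eckardt := isEckardtPoint_stdPoint hk hq hc hl hl0 hQ hT
  isLine := by
    rw [stdLine, single_three, single_four]
    refine isLine_span_pair fun s t h => ?_
    rw [smul_vec5, smul_vec5, vec5_add, vec5_eq_zero_iff] at h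
    simpa using h
  mem_line := fun v hv => mem_stdLine.mpr (mem_stdPoint.mp hv).1
  line_le := fun v hv => by
    rw [← vec5_eta v, mem_stdLine.mp hv, eval_eckardtCubic_stdLine hk hq hc hl]
  avoids := by
    intro H hH m hm hmH hmF
    obtain rfl := (isFixedHyperplane_iff (e := LinearEquiv.refl ℂ _) (by simp) (fun v => rfl)
      hl hl0 H).mp hH
    rw [Submodule.disjoint_def]
    intro x hx hxm
    by_contra hx0
    have hx4 : x 4 = 0 := hmH hxm
    have hx' : x = vec5 0 (x 3) 0 := by
      conv_lhs => rw [← vec5_eta x, mem_stdLine.mp hx, hx4]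
    have hx3 : x 3 ≠ 0 := fun h => hx0 (by rw [hx', h, vec5_zero])
    -- A line of `S` through `S ∩ ℓ` projects to one point `y`, the image of any second vector. It
    -- contains `(y, z, 0)` for every `z`, so `k, q, c` all vanish at `y`.
    obtain ⟨w, hw, hwx⟩ : ∃ w ∈ m, w ∉ Submodule.span ℂ {x} := by
      by_contra! hle
      have h1 := Submodule.finrank_mono (show m ≤ Submodule.span ℂ {x} from hle)
      have h2 : Module.finrank ℂ m = 2 := hm
      rw [h2, finrank_span_singleton hx0] at h1
      omega
    have hw4 : w 4 = 0 := hmH hw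
    have hy : stdProj w ≠ 0 := by
      intro h
      refine hwx (Submodule.mem_span_singleton.mpr ⟨w 3 / x 3, ?_⟩)
      rw [hx', smul_vec5, vec5_three, div_mul_cancel₀ _ hx3]
      conv_rhs => rw [← vec5_eta w, h, hw4]
      simp
    have hz : ∀ z, eval (stdProj w) k * z ^ 2 + 2 * eval (stdProj w) q * z +
        eval (stdProj w) c = 0 := by
      intro z
      have hv : w + ((z - w 3) / x 3) • x = vec5 (stdProj w) z 0 := by
        rw [hx', smul_vec5, vec5_three, div_mul_cancel₀ _ hx3]
        conv_lhs => rw [← vec5_eta w, hw4]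
        rw [vec5_add]
        simp
      have := hmF _ (m.add_mem hw (m.smul_mem ((z - w 3) / x 3) hxm))
      rw [hv, eval_eckardtCubic] at this
      simpa using this
    have h0 := hz 0
    have h1 := hz 1
    have h2 := hz (-1)
    exact hy (avoids_of_quartic_smooth hQ _ (by linear_combination (h1 + h2) / 2 - h0)
      (by linear_combination (h1 - h2) / 4) (by linear_combination h0))

/-- Standard Eckardt triples are the presentations of theta characteristics. -/
theorem isEckardtTriple_iff_isPresentation {Q m : MvPolynomial (Fin 3) ℂ} (hk : k.IsHomogeneous 1)
    (hq : q.IsHomogeneous 2) (hc : c.IsHomogeneous 3) (hl : l.IsHomogeneous 1) :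
    (IsEckardtTriple (eckardtCubic k q c l) stdPoint stdLine ∧
      Associated Q (k * c - q ^ 2) ∧ Associated m k) ↔
    (IsQuarticTriple Q m l ∧ IsPresentation Q m k q c) := by
  constructor
  · rintro ⟨hT, hQ, hm⟩
    have hl0 := line_ne_zero_of_smooth hk hq hc hl hT.smooth
    have hav := bitangent_conic_cubic_disjoint (e := LinearEquiv.refl ℂ _) hT (by simp) (by simp)
      (fun v => rfl) hk hq hc hl hl0
    exact ⟨isQuarticTriple_of_smooth hk hq hc hl hT.smooth hav hQ hm,
      isPresentation_of_smooth hk hq hc (quartic_of_smooth hk hq hc hl hT.smooth hav).1 hQ hm⟩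
  · rintro ⟨hT, hP⟩
    obtain ⟨hQ, hm⟩ := associated_of_isPresentation hT.bitangent.1 hT.bitangent.2.1 hT.smooth.1 hP
    exact ⟨isEckardtTriple_of_quartic hk hq hc hl hT.line_ne_zero (hT.smooth.of_associated hQ.symm)
      (hT.transverse.of_associated hQ.symm), hQ, hm⟩

theorem exists_isPresentation (t : QuarticTriple) : ∃ k q c, IsPresentation t.Q t.m k q c := by
  obtain ⟨Q, m, l, hQ, ⟨hm, hm0, h, hh, c, hc⟩, -, -, -⟩ := t
  have hI : (C Complex.I : MvPolynomial (Fin 3) ℂ) ^ 2 = -1 := by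
    rw [← C_pow, Complex.I_sq, C_neg, C_1]
  have hD : Q = m * c - (C Complex.I * h) ^ 2 := by
    linear_combination hc + h ^ 2 * hI
  have hc3 : c.IsHomogeneous 3 := hm.of_mul_one hm0 (hc ▸ hQ.1.sub (hh.pow 2))
  exact ⟨m, C Complex.I * h, c, isPresentation_of_smooth hm (hh.C_mul _) hc3 (hD ▸ hQ)
    (hD ▸ Associated.refl _) (Associated.refl _)⟩

end Triples

/-! ### Changes of adapted coordinates -/

section CoordChange

variable {g : (Fin 3 → ℂ) ≃ₗ[ℂ] (Fin 3 → ℂ)} {μ : (Fin 3 → ℂ) →ₗ[ℂ] ℂ} {α β : ℂ}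

theorem assemble_plane_apply (g : (Fin 3 → ℂ) ≃ₗ[ℂ] (Fin 3 → ℂ)) (μ : (Fin 3 → ℂ) →ₗ[ℂ] ℂ)
    (α β : ℂ) (v : Fin 5 → ℂ) :
    assemble (planeEmb ∘ₗ (g : (Fin 3 → ℂ) →ₗ[ℂ] (Fin 3 → ℂ)) + μ.smulRight (vec5 0 1 0))
      (vec5 0 α 0) (vec5 0 0 β) v =
    vec5 (g (stdProj v)) (μ (stdProj v) + α * v 3) (β * v 4) := by
  rw [assemble_apply]
  simp [planeEmb_apply, smul_vec5, vec5_add, mul_comm]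

/-- The change of coordinates `(y, z, t) ↦ (g y, μ y + α z, β t)`. -/
def coordChange (g : (Fin 3 → ℂ) ≃ₗ[ℂ] (Fin 3 → ℂ)) (μ : (Fin 3 → ℂ) →ₗ[ℂ] ℂ)
    (hα : α ≠ 0) (hβ : β ≠ 0) : (Fin 5 → ℂ) ≃ₗ[ℂ] (Fin 5 → ℂ) :=
  LinearEquiv.ofInjectiveEndo
    (assemble (planeEmb ∘ₗ (g : (Fin 3 → ℂ) →ₗ[ℂ] (Fin 3 → ℂ)) + μ.smulRight (vec5 0 1 0))
      (vec5 0 α 0) (vec5 0 0 β)) (by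
    rw [← LinearMap.ker_eq_bot, LinearMap.ker_eq_bot']
    intro v hv
    rw [assemble_plane_apply, vec5_eq_zero_iff] at hv
    obtain ⟨h1, h2, h3⟩ := hv
    have hy : stdProj v = 0 := g.map_eq_zero_iff.mp h1
    rw [hy, map_zero, zero_add] at h2
    rw [← vec5_eta v, hy, (mul_eq_zero.mp h2).resolve_left hα, (mul_eq_zero.mp h3).resolve_left hβ,
      vec5_zero])

theorem coordChange_apply (hα : α ≠ 0) (hβ : β ≠ 0) (v : Fin 5 → ℂ) :
    coordChange g μ hα hβ v = vec5 (g (stdProj v)) (μ (stdProj v) + α * v 3) (β * v 4) :=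
  assemble_plane_apply g μ α β v

theorem coordChange_mem_stdPoint (hα : α ≠ 0) (hβ : β ≠ 0) (v : Fin 5 → ℂ) :
    coordChange g μ hα hβ v ∈ stdPoint.submodule ↔ v ∈ stdPoint.submodule := by
  rw [coordChange_apply, mem_stdPoint, mem_stdPoint, stdProj_vec5, vec5_three,
    LinearEquiv.map_eq_zero_iff]
  refine and_congr_right fun h => ?_
  rw [h, map_zero, zero_add, mul_eq_zero, or_iff_right hα]

theorem coordChange_mem_stdLine (hα : α ≠ 0) (hβ : β ≠ 0) (v : Fin 5 → ℂ) :
    coordChange g μ hα hβ v ∈ stdLine ↔ v ∈ stdLine := by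
  rw [coordChange_apply, mem_stdLine, mem_stdLine, stdProj_vec5, LinearEquiv.map_eq_zero_iff]

theorem IsAdapted.trans {T : EckardtTriple} {e : (Fin 5 → ℂ) ≃ₗ[ℂ] (Fin 5 → ℂ)}
    {k q c l k' q' c' l' : MvPolynomial (Fin 3) ℂ} (h : IsAdapted T e k q c l)
    (hk : k'.IsHomogeneous 1) (hq : q'.IsHomogeneous 2) (hc : c'.IsHomogeneous 3)
    (hl : l'.IsHomogeneous 1) (hα : α ≠ 0) (hβ : β ≠ 0)
    (heq : ∀ y z t, eval y k * z ^ 2 + 2 * eval y q * z + eval y c + eval y l * t ^ 2 =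
      eval (g y) k' * (μ y + α * z) ^ 2 + 2 * eval (g y) q' * (μ y + α * z) + eval (g y) c' +
        eval (g y) l' * (β * t) ^ 2) :
    IsAdapted T (e.trans (coordChange g μ hα hβ)) k' q' c' l' where
  hk := hk
  hq := hq
  hc := hc
  hl := hl
  point := Submodule.map_equiv_eq_of_mem_iff _ fun v => by
    rw [LinearEquiv.trans_apply, coordChange_mem_stdPoint, Submodule.mem_of_map_equiv_eq h.point]
  line := Submodule.map_equiv_eq_of_mem_iff _ fun v => by
    rw [LinearEquiv.trans_apply, coordChange_mem_stdLine, Submodule.mem_of_map_equiv_eq h.line]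
  equation := fun v => by
    rw [h.equation, LinearEquiv.trans_apply, coordChange_apply, eval_eckardtCubic,
      eval_eckardtCubic, heq, stdProj_vec5, vec5_three, vec5_four]

end CoordChange

/-- Adapted coordinates with the same projection to the plane differ by an isomorphism of
presentations. -/
theorem IsAdapted.exists_of_stdProj_eq {T : EckardtTriple}
    {e e' : (Fin 5 → ℂ) ≃ₗ[ℂ] (Fin 5 → ℂ)} {k q c l k' q' c' l' : MvPolynomial (Fin 3) ℂ}
    (h : IsAdapted T e k q c l) (h' : IsAdapted T e' k' q' c' l')
    (hproj : ∀ v, stdProj (e' v) = stdProj (e v)) :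
    ∃ (a b : ℂ) (lam : MvPolynomial (Fin 3) ℂ), a ≠ 0 ∧ b ≠ 0 ∧ lam.IsHomogeneous 1 ∧
      k' = C b ^ 2 * k ∧ q' = C b * (k * lam + q) ∧ c' = k * lam ^ 2 + 2 * q * lam + c ∧
      l' = C a * l := by
  let g := e.symm.trans e'
  have hge : ∀ v, g (e v) = e' v := fun v => by simp [g]
  have hgp : ∀ v, stdProj (g v) = stdProj v := fun v => by simp [g, hproj]
  obtain ⟨α, γ, hαγ⟩ : ∃ α γ, g (vec5 0 1 0) = vec5 0 α γ := by
    refine ⟨g (vec5 0 1 0) 3, g (vec5 0 1 0) 4, ?_⟩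
    conv_lhs => rw [← vec5_eta (g (vec5 0 1 0)), hgp, stdProj_vec5]
  obtain ⟨β, hβ⟩ : ∃ β, g (vec5 0 0 1) = vec5 0 0 β := by
    refine ⟨g (vec5 0 0 1) 4, ?_⟩
    -- Both systems send `p` to the standard point.
    have hmem : g (vec5 0 0 1) ∈ stdPoint.submodule := by
      obtain ⟨v, hv⟩ := e.surjective (vec5 0 0 1)
      rw [← hv, hge, Submodule.mem_of_map_equiv_eq h'.point,
        ← Submodule.mem_of_map_equiv_eq h.point, hv, mem_stdPoint]
      simp
    conv_lhs => rw [← vec5_eta (g (vec5 0 0 1)), (mem_stdPoint.mp hmem).1, (mem_stdPoint.mp hmem).2]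
  have hβ0 : β ≠ 0 := by
    rintro rfl
    rw [vec5_zero, LinearEquiv.map_eq_zero_iff, vec5_eq_zero_iff] at hβ
    exact one_ne_zero hβ.2.2
  have hα0 : α ≠ 0 := by
    rintro rfl
    have : g (β • vec5 0 1 0 + (-γ) • vec5 0 0 1) = 0 := by
      rw [map_add, map_smul, map_smul, hαγ, hβ, smul_vec5, smul_vec5, vec5_add, vec5_eq_zero_iff]
      simp [mul_comm]
    rw [LinearEquiv.map_eq_zero_iff, smul_vec5, smul_vec5, vec5_add, vec5_eq_zero_iff] at this
    exact hβ0 (by simpa using this.2.1)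
  let μ : (Fin 3 → ℂ) →ₗ[ℂ] ℂ := LinearMap.proj 3 ∘ₗ (g : (Fin 5 → ℂ) →ₗ[ℂ] (Fin 5 → ℂ)) ∘ₗ planeEmb
  have hg : ∀ y z t, g (vec5 y z t) =
      vec5 y (μ y + z * α) (g (vec5 y 0 0) 4 + z * γ + t * β) := by
    intro y z t
    have h1 : vec5 y z t = vec5 y 0 0 + z • vec5 0 1 0 + t • vec5 0 0 1 := by
      simp [smul_vec5, vec5_add]
    have h2 : g (vec5 y 0 0) = vec5 y (μ y) (g (vec5 y 0 0) 4) := by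
      conv_lhs => rw [← vec5_eta (g (vec5 y 0 0)), hgp, stdProj_vec5]
      rfl
    conv_lhs => rw [h1, map_add, map_add, map_smul, map_smul, hαγ, hβ, h2]
    simp [smul_vec5, vec5_add]
  have heq : ∀ y z t, eval y k * z ^ 2 + 2 * eval y q * z + eval y c + eval y l * t ^ 2 =
      eval y k' * (μ y + z * α) ^ 2 + 2 * eval y q' * (μ y + z * α) + eval y c' +
        eval y l' * (g (vec5 y 0 0) 4 + z * γ + t * β) ^ 2 := by
    intro y z t
    obtain ⟨v, hv⟩ := e.surjective (vec5 y z t)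
    have h1 := h.equation v
    rw [h'.equation, ← hge, hv, hg, eval_eckardtCubic, eval_eckardtCubic] at h1
    simpa using h1.symm
  have hl : ∀ y, eval y l = β ^ 2 * eval y l' := fun y => by
    linear_combination (heq y 0 1 + heq y 0 (-1) - 2 * heq y 0 0) / 2
  -- The new `x₄` could a priori involve `y` and `z`. The terms linear in `t` show that these
  -- contributions vanish after multiplication by `l'`, and only such products enter the comparison
  -- of coefficients.
  have hlν : ∀ y, eval y l' * g (vec5 y 0 0) 4 = 0 := fun y => by
    have : β * (eval y l' * g (vec5 y 0 0) 4) = 0 := by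
      linear_combination (heq y 0 (-1) - heq y 0 1) / 4
    exact (mul_eq_zero.mp this).resolve_left hβ0
  have hlγ : ∀ y, eval y l' * γ = 0 := fun y => by
    have : β * (eval y l' * γ) = 0 := by
      linear_combination (heq y 1 (-1) - heq y 1 1) / 4 - β * hlν y
    exact (mul_eq_zero.mp this).resolve_left hβ0
  have hk : ∀ y, eval y k = α ^ 2 * eval y k' := fun y => by
    linear_combination (heq y 1 0 + heq y (-1) 0 - 2 * heq y 0 0) / 2 + γ * hlγ y
  have hq : ∀ y, eval y q = α * (eval y k' * μ y + eval y q') := fun y => by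
    linear_combination (heq y 1 0 - heq y (-1) 0) / 4 + γ * hlν y
  have hc : ∀ y, eval y c = eval y k' * μ y ^ 2 + 2 * eval y q' * μ y + eval y c' := fun y => by
    linear_combination heq y 0 0 + g (vec5 y 0 0) 4 * hlν y
  -- These constants solve `k = α² k'`, `q = α (k' μ + q')`, `l = β² l'` for the primed data.
  refine ⟨(β ^ 2)⁻¹, α⁻¹, C (-α⁻¹) * linForm μ, inv_ne_zero (pow_ne_zero 2 hβ0), inv_ne_zero hα0,
    (linForm_isHomogeneous μ).C_mul _, ?_, ?_, ?_, ?_⟩ <;>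
  refine MvPolynomial.funext fun y => ?_ <;>
  simp only [map_mul, map_add, map_pow, eval_C, eval_linForm, map_ofNat, hk, hq, hc, hl] <;>
  field_simp <;> ring

/-- The congruence is the substitution of `b z + λ` for `z` in `k z² + 2 q z + c`. -/
theorem quadricMatrix_eq_iff {k q c k' q' c' lam : MvPolynomial (Fin 3) ℂ} {b : ℂ} :
    quadricMatrix k' q' c' =
      (!![C b, lam; 0, 1]).transpose * quadricMatrix k q c * !![C b, lam; 0, 1] ↔
    k' = C b ^ 2 * k ∧ q' = C b * (k * lam + q) ∧ c' = k * lam ^ 2 + 2 * q * lam + c := by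
  have : (!![C b, lam; 0, 1]).transpose * quadricMatrix k q c * !![C b, lam; 0, 1] =
      !![C b ^ 2 * k, C b * (k * lam + q); C b * (k * lam + q),
        k * lam ^ 2 + 2 * q * lam + c] := by
    ext1 i j
    fin_cases i <;> fin_cases j <;>
      simp [quadricMatrix, Matrix.mul_apply, Fin.sum_univ_two] <;> ring
  rw [this, quadricMatrix]
  constructor
  · intro h
    exact ⟨congrFun (congrFun h 0) 0, congrFun (congrFun h 0) 1, congrFun (congrFun h 1) 1⟩
  · rintro ⟨rfl, rfl, rfl⟩; rfl

/-- The data of adapted coordinates over fixed coordinates of the plane. -/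
theorem IsAdapted.exists_same_projection_iff {T : EckardtTriple}
    {e : (Fin 5 → ℂ) ≃ₗ[ℂ] (Fin 5 → ℂ)} {k q c l : MvPolynomial (Fin 3) ℂ}
    (h : IsAdapted T e k q c l) (k' q' c' l' : MvPolynomial (Fin 3) ℂ) :
    (∃ e', IsAdapted T e' k' q' c' l' ∧ ∀ v, stdProj (e' v) = stdProj (e v)) ↔
      ∃ (a b : ℂ) (lam : MvPolynomial (Fin 3) ℂ), a ≠ 0 ∧ b ≠ 0 ∧ lam.IsHomogeneous 1 ∧
        quadricMatrix k' q' c' =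
          (!![C b, lam; 0, 1]).transpose * quadricMatrix k q c * !![C b, lam; 0, 1] ∧
        l' = C a * l := by
  simp only [quadricMatrix_eq_iff]
  constructor
  · rintro ⟨e', h', hproj⟩
    obtain ⟨a, b, lam, ha, hb, hlam, hk, hq, hc, hl⟩ := h.exists_of_stdProj_eq h' hproj
    exact ⟨a, b, lam, ha, hb, hlam, ⟨hk, hq, hc⟩, hl⟩
  · rintro ⟨a, b, lam, ha, hb, hlam, ⟨rfl, rfl, rfl⟩, rfl⟩
    -- Rescaling `x₄` by `r` turns `l` into `a l`; the new `x₃` is `b⁻¹ (z - λ)`, inverse to the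
    -- substitution `b z + λ`.
    obtain ⟨r, hr⟩ := IsAlgClosed.exists_pow_nat_eq a⁻¹ two_pos
    have hr0 : r ≠ 0 := by
      rintro rfl
      exact inv_ne_zero ha (by rw [← hr]; norm_num)
    obtain ⟨L, hL⟩ := hlam.exists_linear
    refine ⟨_, h.trans (g := LinearEquiv.refl ℂ _) (μ := -b⁻¹ • L) (α := b⁻¹) (β := r)
      ?_ ?_ ?_ (h.hl.C_mul a) (inv_ne_zero hb) hr0 fun y z t => ?_, fun v => ?_⟩
    · rw [← C_pow]; exact h.hk.C_mul _
    · exact ((h.hk.mul hlam).add h.hq).C_mul b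
    · have h2 : (2 : MvPolynomial (Fin 3) ℂ) = C 2 := (map_ofNat C 2).symm
      rw [h2]
      exact ((h.hk.mul (hlam.pow 2)).add ((h.hq.C_mul 2).mul hlam)).add h.hc
    · simp only [map_mul, map_add, map_pow, eval_C, map_ofNat, LinearEquiv.refl_apply,
        LinearMap.smul_apply, smul_eq_mul, hL, mul_pow, hr]
      field_simp
      ring
    · rw [LinearEquiv.trans_apply, coordChange_apply, stdProj_vec5, LinearEquiv.refl_apply]

/-! ### The bijection of equivalence classes -/

theorem exists_projectsTo (T : EckardtTriple) : ∃ t, ProjectsTo T t := by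
  obtain ⟨e, k, q, c, l, h⟩ := exists_isAdapted T
  have hav := bitangent_conic_cubic_disjoint T.isTriple h.point h.line h.equation h.hk h.hq h.hc
    h.hl h.line_ne_zero
  exact ⟨⟨_, _, _, isQuarticTriple_of_smooth h.hk h.hq h.hc h.hl h.smooth hav
    (Associated.refl _) (Associated.refl _)⟩, e, k, q, c, l, h, Associated.refl _,
    Associated.refl _, Associated.refl _⟩

theorem exists_projectsTo_quartic (t : QuarticTriple) : ∃ T, ProjectsTo T t := by
  obtain ⟨k, q, c, h⟩ := exists_isPresentation t
  have hl := t.isTriple.line_homogeneous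
  obtain ⟨hT, hQ, hm⟩ := (isEckardtTriple_iff_isPresentation h.1 h.2.1 h.2.2.1 hl).mpr
    ⟨t.isTriple, h⟩
  exact ⟨⟨_, _, _, hT⟩, LinearEquiv.refl ℂ _, k, q, c, t.l,
    ⟨h.1, h.2.1, h.2.2.1, hl, by simp, by simp, fun v => rfl⟩, hQ, hm, Associated.refl _⟩

theorem eval_pull_symm (g : (Fin 3 → ℂ) ≃ₗ[ℂ] (Fin 3 → ℂ)) (P : MvPolynomial (Fin 3) ℂ)
    (y : Fin 3 → ℂ) :
    eval (g y) (pull (g.symm : (Fin 3 → ℂ) →ₗ[ℂ] (Fin 3 → ℂ)) P) = eval y P := by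
  simp

/-- Adapted coordinates after a change of coordinates of the plane. -/
theorem IsAdapted.exists_plane_change {T : EckardtTriple}
    {e : (Fin 5 → ℂ) ≃ₗ[ℂ] (Fin 5 → ℂ)} {k q c l : MvPolynomial (Fin 3) ℂ}
    (h : IsAdapted T e k q c l) (g : (Fin 3 → ℂ) ≃ₗ[ℂ] (Fin 3 → ℂ)) :
    ∃ e', (∀ v, stdProj (e' v) = g (stdProj (e v))) ∧
      IsAdapted T e' (pull (g.symm : (Fin 3 → ℂ) →ₗ[ℂ] (Fin 3 → ℂ)) k)
        (pull (g.symm : (Fin 3 → ℂ) →ₗ[ℂ] (Fin 3 → ℂ)) q)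
        (pull (g.symm : (Fin 3 → ℂ) →ₗ[ℂ] (Fin 3 → ℂ)) c)
        (pull (g.symm : (Fin 3 → ℂ) →ₗ[ℂ] (Fin 3 → ℂ)) l) := by
  refine ⟨e.trans (coordChange g 0 one_ne_zero one_ne_zero), fun v => ?_,
    h.trans (pull_isHomogeneous _ h.hk) (pull_isHomogeneous _ h.hq) (pull_isHomogeneous _ h.hc)
      (pull_isHomogeneous _ h.hl) _ _ fun y z t => ?_⟩
  · rw [LinearEquiv.trans_apply, coordChange_apply, stdProj_vec5]
  · simp only [eval_pull_symm, LinearMap.zero_apply, zero_add, one_mul]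

theorem associated_pull_symm {g : (Fin 3 → ℂ) ≃ₗ[ℂ] (Fin 3 → ℂ)} {P P' R : MvPolynomial (Fin 3) ℂ}
    {a : ℂˣ} (h : ∀ y, eval (g y) P' = a * eval y P) (hP : Associated P R) :
    Associated P' (pull (g.symm : (Fin 3 → ℂ) →ₗ[ℂ] (Fin 3 → ℂ)) R) := by
  obtain ⟨b, hb, rfl⟩ := associated_iff_C_mul.mp hP
  refine associated_iff_C_mul.mpr ⟨a * b, mul_ne_zero a.ne_zero hb, MvPolynomial.funext fun y => ?_⟩
  obtain ⟨y, rfl⟩ := g.surjective y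
  rw [h, map_mul, map_mul, eval_C, eval_C, eval_pull_symm, mul_assoc]

theorem ProjectsTo.of_equivalent_right {T : EckardtTriple} {t t' : QuarticTriple}
    (h : ProjectsTo T t) (ht : t.Equivalent t') : ProjectsTo T t' := by
  obtain ⟨e, k, q, c, l, hA, hQ, hm, hl⟩ := h
  obtain ⟨g, a, b, d, ha, hb, hd⟩ := ht
  obtain ⟨e', -, hA'⟩ := hA.exists_plane_change g
  refine ⟨e', _, _, _, _, hA', ?_, associated_pull_symm hb hm, associated_pull_symm hd hl⟩
  simpa using associated_pull_symm ha hQ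

/-- The constant relating the two equations is absorbed by scaling `k, q, c, l`, which scales the
discriminant by its square. -/
theorem ProjectsTo.of_equivalent_left {T T' : EckardtTriple} {t : QuarticTriple}
    (h : ProjectsTo T t) (hT : T.Equivalent T') : ProjectsTo T' t := by
  obtain ⟨e, k, q, c, l, hA, hQ, hm, hl⟩ := h
  obtain ⟨g, a, hF, hp, hℓ⟩ := hT
  have ha : (a : ℂ) ≠ 0 := a.ne_zero
  refine ⟨g.symm.trans e, C (a : ℂ) * k, C (a : ℂ) * q, C (a : ℂ) * c, C (a : ℂ) * l,
    ⟨hA.hk.C_mul _, hA.hq.C_mul _, hA.hc.C_mul _, hA.hl.C_mul _, ?_, ?_, fun v => ?_⟩, ?_, ?_, ?_⟩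
  · refine Submodule.map_equiv_eq_of_mem_iff _ fun v => ?_
    obtain ⟨v, rfl⟩ := g.surjective v
    rw [LinearEquiv.trans_apply, g.symm_apply_apply, Submodule.mem_of_map_equiv_eq hA.point,
      Submodule.mem_of_map_equiv_eq hp]
  · refine Submodule.map_equiv_eq_of_mem_iff _ fun v => ?_
    obtain ⟨v, rfl⟩ := g.surjective v
    rw [LinearEquiv.trans_apply, g.symm_apply_apply, Submodule.mem_of_map_equiv_eq hA.line,
      Submodule.mem_of_map_equiv_eq hℓ]
  · obtain ⟨v, rfl⟩ := g.surjective v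
    rw [hF, LinearEquiv.trans_apply, g.symm_apply_apply, hA.equation, eval_eckardtCubic,
      eval_eckardtCubic]
    simp only [map_mul, eval_C]
    ring
  · refine hQ.trans (associated_iff_C_mul.mpr ⟨(a : ℂ) ^ 2, pow_ne_zero 2 ha, ?_⟩).symm
    rw [C_pow]; ring
  · exact hm.trans (associated_iff_C_mul.mpr ⟨a, ha, rfl⟩).symm
  · exact hl.trans (associated_iff_C_mul.mpr ⟨a, ha, rfl⟩).symm

theorem exists_unit_eval_of_associated {g : (Fin 3 → ℂ) ≃ₗ[ℂ] (Fin 3 → ℂ)}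
    {P P' R R' : MvPolynomial (Fin 3) ℂ} {b : ℂ} (hb : b ≠ 0) (hP : Associated P R)
    (hP' : Associated P' R') (hR : ∀ y, eval (g y) R' = b * eval y R) :
    ∃ a : ℂˣ, ∀ y, eval (g y) P' = a * eval y P := by
  obtain ⟨r, hr, rfl⟩ := associated_iff_C_mul.mp hP
  obtain ⟨r', hr', rfl⟩ := associated_iff_C_mul.mp hP'
  refine ⟨Units.mk0 (r' * b / r) (div_ne_zero (mul_ne_zero hr' hb) hr), fun y => ?_⟩
  simp only [map_mul, eval_C, hR, Units.val_mk0]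
  field_simp

/-- Both projections have kernel `ℓ`, so they differ by an automorphism `g` of the plane. After
moving the first data by `g` the projections agree, and the congruence of `N` multiplies both
discriminant and `k` by `b²`. -/
theorem ProjectsTo.equivalent_right {T : EckardtTriple} {t t' : QuarticTriple}
    (h : ProjectsTo T t) (h' : ProjectsTo T t') : t.Equivalent t' := by
  obtain ⟨e, k, q, c, l, hA, hQ, hm, hl⟩ := h
  obtain ⟨e', k', q', c', l', hA', hQ', hm', hl'⟩ := h'
  have hline : ∀ v, stdProj (e v) = 0 ↔ stdProj (e' v) = 0 := fun v => by
    rw [← mem_stdLine, ← mem_stdLine, Submodule.mem_of_map_equiv_eq hA.line,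
      Submodule.mem_of_map_equiv_eq hA'.line]
  let γ : (Fin 3 → ℂ) →ₗ[ℂ] (Fin 3 → ℂ) :=
    stdProj ∘ₗ (e' : (Fin 5 → ℂ) →ₗ[ℂ] (Fin 5 → ℂ)) ∘ₗ
      (e.symm : (Fin 5 → ℂ) →ₗ[ℂ] (Fin 5 → ℂ)) ∘ₗ planeEmb
  have hγ : ∀ y, γ y = stdProj (e' (e.symm (vec5 y 0 0))) := fun y => rfl
  have hinj : Function.Injective γ := by
    rw [← LinearMap.ker_eq_bot, LinearMap.ker_eq_bot']
    intro y hy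
    rw [hγ, ← hline, e.apply_symm_apply, stdProj_vec5] at hy
    exact hy
  let g := LinearEquiv.ofInjectiveEndo γ hinj
  have hg : ∀ v, stdProj (e' v) = g (stdProj (e v)) := by
    intro v
    change _ = γ _
    rw [hγ, ← sub_eq_zero, ← map_sub, ← map_sub, ← hline, map_sub, map_sub, e.apply_symm_apply,
      stdProj_vec5, sub_self]
  obtain ⟨e'', he'', hA''⟩ := hA.exists_plane_change g
  obtain ⟨a, b, lam, ha, hb, -, hk₁, hq₁, hc₁, hl₁⟩ :=
    hA''.exists_of_stdProj_eq hA' fun v => by rw [hg, he'']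
  obtain ⟨u₁, h₁⟩ := exists_unit_eval_of_associated (g := g) (b := b ^ 2) (pow_ne_zero 2 hb) hQ hQ'
    fun y => by
      rw [hk₁, hq₁, hc₁]
      simp only [map_sub, map_add, map_mul, map_pow, map_ofNat, eval_C, eval_pull_symm]
      ring
  obtain ⟨u₂, h₂⟩ := exists_unit_eval_of_associated (g := g) (b := b ^ 2) (pow_ne_zero 2 hb) hm hm'
    fun y => by simp only [hk₁, map_mul, map_pow, eval_C, eval_pull_symm]
  obtain ⟨u₃, h₃⟩ := exists_unit_eval_of_associated (g := g) ha hl hl'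
    fun y => by simp only [hl₁, map_mul, eval_C, eval_pull_symm]
  exact ⟨g, u₁, u₂, u₃, h₁, h₂, h₃⟩

/-- Two presentations of the same theta characteristic, up to constants. -/
theorem exists_presentation_change {k q c k' q' c' : MvPolynomial (Fin 3) ℂ}
    (hk : k.IsHomogeneous 1) (hk0 : k ≠ 0) (hq : q.IsHomogeneous 2) (hq' : q'.IsHomogeneous 2)
    {a r : ℂ} (hka : k' = C a * k)
    (hD : k' * c' - q' ^ 2 = C r * (k * c - q ^ 2)) :
    ∃ (ρ : ℂ) (lam : MvPolynomial (Fin 3) ℂ), ρ ^ 2 = r ∧ lam.IsHomogeneous 1 ∧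
      q' = C ρ * q + k * lam ∧ C a * c' = C r * c + 2 * C ρ * q * lam + k * lam ^ 2 := by
  obtain ⟨ρ, hρ⟩ := IsAlgClosed.exists_pow_nat_eq r two_pos
  have hCρ : (C r : MvPolynomial (Fin 3) ℂ) = C ρ ^ 2 := by rw [← C_pow, hρ]
  obtain ⟨σ, hσ, lam, hlam⟩ : ∃ σ : ℂ, σ ^ 2 = r ∧ k ∣ q' - C σ * q := by
    -- The product is `q'² - r q²`, a multiple of `k` by the equality of discriminants. The factor
    -- divisible by `k` decides the sign of the square root.
    have hdvd : k ∣ (q' - C ρ * q) * (q' - C (-ρ) * q) := by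
      refine ⟨C a * c' - C r * c, ?_⟩
      rw [C_neg]
      linear_combination -hD + c' * hka + q ^ 2 * hCρ
    rcases (hk.irreducible_of_one hk0).prime.dvd_or_dvd hdvd with h | h
    · exact ⟨ρ, hρ, h⟩
    · exact ⟨-ρ, by rw [neg_sq, hρ], h⟩
  have hCσ : (C r : MvPolynomial (Fin 3) ℂ) = C σ ^ 2 := by rw [← C_pow, hσ]
  refine ⟨σ, lam, hσ, hk.of_mul_one hk0 (hlam ▸ hq'.sub (hq.C_mul σ)), by linear_combination hlam,
    mul_left_cancel₀ hk0 ?_⟩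
  have h1 : q' = C σ * q + k * lam := by linear_combination hlam
  linear_combination hD - c' * hka + (q' + C σ * q + k * lam) * h1 - q ^ 2 * hCσ

theorem ProjectsTo.equivalent_left {T T' : EckardtTriple} {t : QuarticTriple}
    (h : ProjectsTo T t) (h' : ProjectsTo T' t) : T.Equivalent T' := by
  obtain ⟨e, k, q, c, l, hA, hQ, hm, hl⟩ := h
  obtain ⟨e', k', q', c', l', hA', hQ', hm', hl'⟩ := h'
  obtain ⟨r, hr, hD⟩ := associated_iff_C_mul.mp (hQ'.symm.trans hQ)
  obtain ⟨a, ha, hka⟩ := associated_iff_C_mul.mp (hm'.symm.trans hm)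
  obtain ⟨b, hb, hlb⟩ := associated_iff_C_mul.mp (hl'.symm.trans hl)
  have hk0 : k ≠ 0 := hm.ne_zero_iff.mp t.isTriple.bitangent.2.1
  obtain ⟨ρ, lam, hρ, hlam, hq₁, hc₁⟩ :=
    exists_presentation_change hA.hk hk0 hA.hq hA'.hq hka hD
  -- The substitution `z ↦ (λ + a z) / ρ` turns `k z² + 2 q z + c` into `a / r` times its primed
  -- version. The factor `τ` makes the term `l t²` scale by the same constant.
  obtain ⟨τ, hτ⟩ := IsAlgClosed.exists_pow_nat_eq (a * b / r) two_pos
  have hρ0 : ρ ≠ 0 := by rintro rfl; exact hr (by rw [← hρ]; norm_num)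
  have hτ0 : τ ≠ 0 := by
    rintro rfl
    exact div_ne_zero (mul_ne_zero ha hb) hr (by rw [← hτ]; norm_num)
  obtain ⟨L, hL⟩ := hlam.exists_linear
  let G := coordChange (LinearEquiv.refl ℂ (Fin 3 → ℂ)) (ρ⁻¹ • L) (div_ne_zero ha hρ0) hτ0
  have hG : ∀ v, G v = vec5 (stdProj v) (ρ⁻¹ * L (stdProj v) + a / ρ * v 3) (τ * v 4) :=
    fun v => coordChange_apply _ _ v
  have hGF : ∀ v, eval v (eckardtCubic k' q' c' l') =
      r / a * eval (G v) (eckardtCubic k q c l) := by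
    intro v
    rw [hG, eval_eckardtCubic, eval_eckardtCubic, stdProj_vec5, vec5_three, vec5_four, mul_pow τ, hτ,
      ← hL]
    have hc₂ := congrArg (eval (stdProj v)) hc₁
    simp only [map_mul, map_add, map_pow, eval_C, map_ofNat] at hc₂
    have hc₃ : eval (stdProj v) c' = (r * eval (stdProj v) c +
        2 * ρ * eval (stdProj v) q * eval (stdProj v) lam +
        eval (stdProj v) k * eval (stdProj v) lam ^ 2) / a := by
      rw [eq_div_iff ha, mul_comm]; exact hc₂
    rw [hc₃, hka, hlb, hq₁, ← hρ]
    simp only [map_mul, map_add, eval_C]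
    field_simp
    ring
  refine ⟨(e.trans G.symm).trans e'.symm, Units.mk0 (r / a) (div_ne_zero hr ha), fun v => ?_, ?_, ?_⟩
  · rw [hA'.equation, LinearEquiv.trans_apply, LinearEquiv.trans_apply, e'.apply_symm_apply, hGF,
      G.apply_symm_apply, hA.equation, Units.val_mk0]
  · refine Submodule.map_equiv_eq_of_mem_iff _ fun v => ?_
    rw [← Submodule.mem_of_map_equiv_eq hA'.point, LinearEquiv.trans_apply, LinearEquiv.trans_apply,
      e'.apply_symm_apply, ← coordChange_mem_stdPoint (div_ne_zero ha hρ0) hτ0]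
    change G (G.symm (e v)) ∈ _ ↔ _
    rw [G.apply_symm_apply, Submodule.mem_of_map_equiv_eq hA.point]
  · refine Submodule.map_equiv_eq_of_mem_iff _ fun v => ?_
    rw [← Submodule.mem_of_map_equiv_eq hA'.line, LinearEquiv.trans_apply, LinearEquiv.trans_apply,
      e'.apply_symm_apply, ← coordChange_mem_stdLine (div_ne_zero ha hρ0) hτ0]
    change G (G.symm (e v)) ∈ _ ↔ _
    rw [G.apply_symm_apply, Submodule.mem_of_map_equiv_eq hA.line]

/-- Projection induces a bijection of projective equivalence classes. -/
theorem exists_projection_equiv :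
    ∃ Φ : Quotient EckardtTriple.setoid ≃ Quotient QuarticTriple.setoid,
      ∀ (T : EckardtTriple) (t : QuarticTriple),
        Φ (Quotient.mk _ T) = Quotient.mk _ t ↔ ProjectsTo T t := by
  choose f hf using exists_projectsTo
  let Φ : Quotient EckardtTriple.setoid → Quotient QuarticTriple.setoid :=
    Quotient.lift (fun T => Quotient.mk _ (f T)) fun T T' h =>
      Quotient.sound (((hf T).of_equivalent_left h).equivalent_right (hf T'))
  have hΦ : ∀ T t, Φ (Quotient.mk _ T) = Quotient.mk _ t ↔ ProjectsTo T t := fun T t =>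
    ⟨fun h => (hf T).of_equivalent_right (Quotient.exact h),
      fun h => Quotient.sound ((hf T).equivalent_right h)⟩
  refine ⟨Equiv.ofBijective Φ ⟨?_, ?_⟩, hΦ⟩
  · rintro ⟨T⟩ ⟨T'⟩ h
    exact Quotient.sound ((hf T).equivalent_left ((hΦ T' (f T)).mp h.symm))
  · rintro ⟨t⟩
    obtain ⟨T, hT⟩ := exists_projectsTo_quartic t
    exact ⟨Quotient.mk _ T, (hΦ T t).mpr hT⟩

/-! ### The conic fibration and the tangent plane -/

theorem LinearMap.apply_comb_self_of_symm {V : Type*} [AddCommGroup V] [Module ℂ V]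
    (B : V →ₗ[ℂ] V →ₗ[ℂ] ℂ) (hB : ∀ v w, B v w = B w v) (x y z : V) (s t u : ℂ) :
    B (s • x + t • y + u • z) (s • x + t • y + u • z) =
      s ^ 2 * B x x + t ^ 2 * B y y + u ^ 2 * B z z + 2 * s * t * B x y + 2 * s * u * B x z +
        2 * t * u * B y z := by
  simp only [map_add, map_smul, LinearMap.add_apply, LinearMap.smul_apply, smul_eq_mul, hB y x,
    hB z x, hB z y]
  ring

section Geometry

variable {T : EckardtTriple} {e : (Fin 5 → ℂ) ≃ₗ[ℂ] (Fin 5 → ℂ)}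
  {k q c l : MvPolynomial (Fin 3) ℂ}

theorem mem_comap_plane {y : Fin 3 → ℂ} {v : Fin 5 → ℂ} :
    v ∈ (Submodule.span ℂ {y}).comap (stdProj ∘ₗ (e : (Fin 5 → ℂ) →ₗ[ℂ] (Fin 5 → ℂ))) ↔
      ∃ s z t : ℂ, v = s • e.symm (vec5 y 0 0) + z • e.symm (vec5 0 1 0) +
        t • e.symm (vec5 0 0 1) := by
  have key : ∀ s z t : ℂ, s • e.symm (vec5 y 0 0) + z • e.symm (vec5 0 1 0) +
        t • e.symm (vec5 0 0 1) = e.symm (vec5 (s • y) z t) := by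
    intro s z t
    rw [← map_smul, ← map_smul, ← map_smul, ← map_add, ← map_add]
    simp [smul_vec5, vec5_add]
  simp only [key]
  rw [Submodule.mem_comap, Submodule.mem_span_singleton]
  constructor
  · rintro ⟨s, hs⟩
    refine ⟨s, e v 3, e v 4, ?_⟩
    rw [LinearEquiv.eq_symm_apply, hs]
    exact (vec5_eta (e v)).symm
  · rintro ⟨s, z, t, rfl⟩
    exact ⟨s, by simp⟩

theorem IsAdapted.eval_plane (h : IsAdapted T e k q c l) (y : Fin 3 → ℂ) (s z t : ℂ) :
    eval (s • e.symm (vec5 y 0 0) + z • e.symm (vec5 0 1 0) + t • e.symm (vec5 0 0 1)) T.F =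
      s * (eval y k * z ^ 2 + 2 * s * eval y q * z + s ^ 2 * eval y c + eval y l * t ^ 2) := by
  rw [h.equation]
  simp only [map_add, map_smul, e.apply_symm_apply, smul_vec5, vec5_add]
  rw [eval_eckardtCubic]
  simp only [smul_zero, add_zero, zero_add, mul_one, mul_zero, stdProj_vec5, vec5_three, vec5_four,
    h.hk.eval_smul, h.hq.eval_smul, h.hc.eval_smul, h.hl.eval_smul]
  ring

/-- The residual conic over a point is singular exactly over the discriminant curve. -/
theorem IsAdapted.residualConicSingular_iff (h : IsAdapted T e k q c l) {y : Fin 3 → ℂ}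
    (hy : y ≠ 0) :
    ResidualConicSingular T.F T.ℓ
        ((Submodule.span ℂ {y}).comap (stdProj ∘ₗ (e : (Fin 5 → ℂ) →ₗ[ℂ] (Fin 5 → ℂ)))) ↔
      eval y (k * c - q ^ 2) = 0 ∨ eval y l = 0 := by
  rw [map_sub, map_mul, map_pow]
  have hℓ : ∀ v, v ∈ T.ℓ ↔ stdProj (e v) = 0 := fun v => by
    rw [← mem_stdLine, Submodule.mem_of_map_equiv_eq h.line]
  have hv : ∀ s z t : ℂ, e (s • e.symm (vec5 y 0 0) + z • e.symm (vec5 0 1 0) +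
      t • e.symm (vec5 0 0 1)) = vec5 (s • y) z t := by
    intro s z t; simp [smul_vec5, vec5_add]
  constructor
  · rintro ⟨lam, B, hB, hU, hF, v, hvU, hv0, hsing⟩
    set x₀ := e.symm (vec5 y 0 0) with hx₀
    set x₁ := e.symm (vec5 0 1 0) with hx₁
    set x₂ := e.symm (vec5 0 0 1) with hx₂
    have hmem : ∀ s z t : ℂ, s • x₀ + z • x₁ + t • x₂ ∈ (Submodule.span ℂ {y}).comap
        (stdProj ∘ₗ (e : (Fin 5 → ℂ) →ₗ[ℂ] (Fin 5 → ℂ))) :=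
      fun s z t => mem_comap_plane.mpr ⟨s, z, t, rfl⟩
    have m₀ := hmem 1 0 0
    have m₁ := hmem 0 1 0
    have m₂ := hmem 0 0 1
    simp only [one_smul, zero_smul, add_zero, zero_add] at m₀ m₁ m₂
    have hlam : ∀ x ∈ T.ℓ, lam x = 0 := fun x hx => by
      rw [← hU] at hx; exact hx.2
    have h₁ : lam x₁ = 0 := hlam _ ((hℓ _).mpr (by simp [hx₁]))
    have h₂ : lam x₂ = 0 := hlam _ ((hℓ _).mpr (by simp [hx₂]))
    -- The line is all of `ker lam` in the plane, so `lam` is nonzero off it.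
    have h₀ : lam x₀ ≠ 0 := by
      intro h0
      have : x₀ ∈ T.ℓ := hU ▸ ⟨m₀, h0⟩
      rw [hℓ, hx₀, e.apply_symm_apply, stdProj_vec5] at this
      exact hy this
    set κ := lam x₀
    -- Cancelling `s` identifies the Gram matrix of `κ B` in the basis `x₀, x₁, x₂` with the blocks
    -- `(c, q; q, k)` and `(l)`.
    have heq : ∀ s z t : ℂ, s * (eval y k * z ^ 2 + 2 * s * eval y q * z + s ^ 2 * eval y c +
        eval y l * t ^ 2) = s * κ * (s ^ 2 * B x₀ x₀ + z ^ 2 * B x₁ x₁ + t ^ 2 * B x₂ x₂ +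
          2 * s * z * B x₀ x₁ + 2 * s * t * B x₀ x₂ + 2 * z * t * B x₁ x₂) := by
      intro s z t
      rw [← h.eval_plane, hF _ (hmem s z t), LinearMap.apply_comb_self_of_symm B hB, map_add, map_add,
        map_smul, map_smul, map_smul, h₁, h₂]
      simp [κ]
    have e00 : eval y c = κ * B x₀ x₀ := by linear_combination heq 1 0 0
    have e11 : eval y k = κ * B x₁ x₁ := by
      linear_combination (heq 1 1 0 + heq 1 (-1) 0) / 2 - heq 1 0 0
    have e01 : eval y q = κ * B x₀ x₁ := by
      linear_combination (heq 1 1 0 - heq 1 (-1) 0) / 4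
    have e22 : eval y l = κ * B x₂ x₂ := by
      linear_combination (heq 1 0 1 + heq 1 0 (-1)) / 2 - heq 1 0 0
    have e02 : κ * B x₀ x₂ = 0 := by
      linear_combination (heq 1 0 (-1) - heq 1 0 1) / 4
    have e12 : κ * B x₁ x₂ = 0 := by
      linear_combination (heq 1 1 (-1) - heq 1 1 1) / 4 - e02
    obtain ⟨s, z, t, rfl⟩ := mem_comap_plane.mp hvU
    have s₀ := hsing x₀ m₀
    have s₁ := hsing x₁ m₁
    have s₂ := hsing x₂ m₂
    simp only [map_add, map_smul, LinearMap.add_apply, LinearMap.smul_apply, smul_eq_mul] at s₀ s₁ s₂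
    rw [hB x₁ x₀, hB x₂ x₀] at s₀
    rw [hB x₂ x₁] at s₁
    have f₀ : s * eval y c + z * eval y q = 0 := by
      linear_combination κ * s₀ + s * e00 + z * e01 - t * e02
    have f₁ : s * eval y q + z * eval y k = 0 := by
      linear_combination κ * s₁ + s * e01 + z * e11 - t * e12
    have f₂ : t * eval y l = 0 := by
      linear_combination κ * s₂ - s * e02 - z * e12 + t * e22
    by_cases ht : t = 0
    · left
      by_cases hs : s = 0
      · have hz : z ≠ 0 := by rintro rfl; exact hv0 (by simp [hs, ht])
        have : z * (eval y k * eval y c - eval y q ^ 2) = 0 := by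
          linear_combination eval y c * f₁ - eval y q * f₀
        exact (mul_eq_zero.mp this).resolve_left hz
      · have : s * (eval y k * eval y c - eval y q ^ 2) = 0 := by
          linear_combination eval y k * f₀ - eval y q * f₁
        exact (mul_eq_zero.mp this).resolve_left hs
    · exact Or.inr ((mul_eq_zero.mp f₂).resolve_left ht)
  · intro hor
    obtain ⟨lam₀, hlam₀⟩ : ∃ f : (Fin 3 → ℂ) →ₗ[ℂ] ℂ, f y = 1 :=
      Module.Projective.exists_dual_eq_one ℂ hy
    let S : (Fin 5 → ℂ) →ₗ[ℂ] ℂ := lam₀ ∘ₗ stdProj ∘ₗ (e : (Fin 5 → ℂ) →ₗ[ℂ] (Fin 5 → ℂ))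
    have hS : ∀ s z t : ℂ, S (s • e.symm (vec5 y 0 0) + z • e.symm (vec5 0 1 0) +
        t • e.symm (vec5 0 0 1)) = s := by
      intro s z t
      change lam₀ (stdProj (e _)) = s
      rw [hv, stdProj_vec5, map_smul, hlam₀, smul_eq_mul, mul_one]
    let B : (Fin 5 → ℂ) →ₗ[ℂ] (Fin 5 → ℂ) →ₗ[ℂ] ℂ := LinearMap.mk₂ ℂ
      (fun v w => eval y k * (e v 3 * e w 3) + eval y q * (S v * e w 3 + S w * e v 3) +
        eval y c * (S v * S w) + eval y l * (e v 4 * e w 4))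
      (fun u v w => by simp only [map_add, Pi.add_apply]; ring)
      (fun a v w => by simp only [map_smul, Pi.smul_apply, smul_eq_mul]; ring)
      (fun u v w => by simp only [map_add, Pi.add_apply]; ring)
      (fun a v w => by simp only [map_smul, Pi.smul_apply, smul_eq_mul]; ring)
    have hB : ∀ v w, B v w = eval y k * (e v 3 * e w 3) + eval y q * (S v * e w 3 + S w * e v 3) +
        eval y c * (S v * S w) + eval y l * (e v 4 * e w 4) := fun v w => rfl
    -- A null vector of the Gram matrix: `(k, -q, 0)` over the quartic, or `(0, 1, 0)` where `k = q
    -- = 0`, and `(0, 0, 1)` over the line `l = 0`.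
    obtain ⟨s, z, t, hne, f₀, f₁, f₂⟩ : ∃ s z t : ℂ, ¬ (s = 0 ∧ z = 0 ∧ t = 0) ∧
        s * eval y c + z * eval y q = 0 ∧ s * eval y q + z * eval y k = 0 ∧ t * eval y l = 0 := by
      rcases hor with hD | hl
      · by_cases hkq : eval y k = 0 ∧ eval y q = 0
        · exact ⟨0, 1, 0, by simp, by simp [hkq.2], by simp [hkq.1], by simp⟩
        · exact ⟨eval y k, -eval y q, 0, by simpa using hkq, by linear_combination hD, by ring,
            by ring⟩
      · exact ⟨0, 0, 1, by simp, by simp, by simp, by simp [hl]⟩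
    refine ⟨S, B, fun v w => by rw [hB, hB]; ring, ?_, ?_, _, mem_comap_plane.mpr ⟨s, z, t, rfl⟩,
      ?_, ?_⟩
    · ext v
      rw [Submodule.mem_inf, LinearMap.mem_ker, hℓ]
      constructor
      · rintro ⟨hvU, hvS⟩
        obtain ⟨s, z, t, rfl⟩ := mem_comap_plane.mp hvU
        rw [hS] at hvS
        rw [hv, stdProj_vec5, hvS, zero_smul]
      · intro h0
        refine ⟨?_, ?_⟩
        · rw [Submodule.mem_comap]
          change stdProj (e v) ∈ _
          rw [h0]; exact Submodule.zero_mem _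
        · change lam₀ (stdProj (e v)) = 0
          rw [h0, map_zero]
    · intro v hvU
      obtain ⟨s, z, t, rfl⟩ := mem_comap_plane.mp hvU
      rw [h.eval_plane, hB, hS, hv, vec5_three, vec5_four]
      ring
    · intro h0
      have := congrArg e h0
      rw [hv, map_zero, vec5_eq_zero_iff] at this
      exact hne ⟨(smul_eq_zero.mp this.1).resolve_right hy, this.2⟩
    · intro w hwU
      obtain ⟨s', z', t', rfl⟩ := mem_comap_plane.mp hwU
      rw [hB, hS, hS, hv, hv]
      simp only [vec5_three, vec5_four]
      linear_combination s' * f₀ + z' * f₁ + t' * f₂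

theorem IsAdapted.isFixedHyperplane_iff (h : IsAdapted T e k q c l)
    (H : Submodule ℂ (Fin 5 → ℂ)) :
    IsFixedHyperplane T.F T.p H ↔ H = LinearMap.ker (lastCoord e) :=
  _root_.isFixedHyperplane_iff h.point h.equation h.hl h.line_ne_zero H

/-- The bitangent is the projection of the tangent plane of the cubic surface at its point on the
line. -/
theorem IsAdapted.exists_mem_tangentSpace_iff (h : IsAdapted T e k q c l)
    {H : Submodule ℂ (Fin 5 → ℂ)} (hH : IsFixedHyperplane T.F T.p H) {w : Fin 5 → ℂ}
    (hw : w ∈ T.ℓ ⊓ H) (hw0 : w ≠ 0) (y : Fin 3 → ℂ) :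
    (∃ v ∈ H ⊓ tangentSpace T.F w, stdProj (e v) = y) ↔ eval y k = 0 := by
  obtain rfl := (h.isFixedHyperplane_iff H).mp hH
  have h4 : e w 4 = 0 := hw.2
  have hew : e w = vec5 0 (e w 3) 0 := by
    have := mem_stdLine.mp ((Submodule.mem_of_map_equiv_eq h.line w).mpr hw.1)
    conv_lhs => rw [← vec5_eta (e w), this, h4]
  have hw3 : e w 3 ≠ 0 := by
    intro h3
    rw [h3, vec5_zero, LinearEquiv.map_eq_zero_iff] at hew
    exact hw0 hew
  -- Since `x₄ = 0` at `w`, the differential there is a nonzero multiple of `k`.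
  have hd : ∀ v, v ∈ tangentSpace T.F w ↔ eval (stdProj (e v)) k = 0 := by
    intro v
    rw [tangentSpace_eq_ker, LinearMap.mem_ker,
      formDiff_comp (F := eckardtCubic k q c l) (e : (Fin 5 → ℂ) →ₗ[ℂ] (Fin 5 → ℂ))
        (fun v => (h.equation v).symm), LinearEquiv.coe_coe, hew,
      formDiff_eckardtCubic_stdLine _ h.hk h.hq h.hc h.hl]
    simp [hw3]
  constructor
  · rintro ⟨v, ⟨-, hv⟩, rfl⟩
    exact (hd v).mp hv
  · intro hy
    refine ⟨e.symm (vec5 y 0 0), ⟨?_, ?_⟩, by simp⟩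
    · change e (e.symm _) 4 = 0
      simp
    · exact (hd _).mpr (by simpa using hy)

end Geometry

end

theorem theoremT :
    -- projection from the line induces a bijection of projective equivalence classes
    (∃ Φ : Quotient EckardtTriple.setoid ≃ Quotient QuarticTriple.setoid,
      ∀ (T : EckardtTriple) (t : QuarticTriple),
        Φ (Quotient.mk _ T) = Quotient.mk _ t ↔ ProjectsTo T t) ∧
    -- in coordinates: embedded triples correspond to presentations of the theta characteristic;
    -- in particular the cubic constructed from a presentation is smooth
    (∀ k q c l Q m : MvPolynomial (Fin 3) ℂ,
      k.IsHomogeneous 1 → q.IsHomogeneous 2 → c.IsHomogeneous 3 → l.IsHomogeneous 1 →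
      ((IsEckardtTriple (eckardtCubic k q c l) stdPoint stdLine ∧
          Associated Q (k * c - q ^ 2) ∧ Associated m k) ↔
        (IsQuarticTriple Q m l ∧ IsPresentation Q m k q c))) ∧
    -- adapted coordinates and presentations always exist
    (∀ T : EckardtTriple, ∃ e k q c l, IsAdapted T e k q c l) ∧
    (∀ t : QuarticTriple, ∃ k q c, IsPresentation t.Q t.m k q c) ∧
    -- for a fixed projection to the plane, the data are unique up to isomorphism of presentations
    (∀ (T : EckardtTriple) (e : (Fin 5 → ℂ) ≃ₗ[ℂ] (Fin 5 → ℂ)) (k q c l : MvPolynomial (Fin 3) ℂ),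
      IsAdapted T e k q c l → ∀ k' q' c' l' : MvPolynomial (Fin 3) ℂ,
      ((∃ e', IsAdapted T e' k' q' c' l' ∧ ∀ v, stdProj (e' v) = stdProj (e v)) ↔
        ∃ (a b : ℂ) (lam : MvPolynomial (Fin 3) ℂ), a ≠ 0 ∧ b ≠ 0 ∧ lam.IsHomogeneous 1 ∧
          quadricMatrix k' q' c' =
            (!![C b, lam; 0, 1]).transpose * quadricMatrix k q c * !![C b, lam; 0, 1] ∧
          l' = C a * l)) ∧
    -- the cubic surface `S` attached to `(X, p)` is well defined
    (∀ T : EckardtTriple, ∃! H, IsFixedHyperplane T.F T.p H) ∧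
    -- geometrically: `C ∪ L` is the discriminant of the fibration in conics, and the bitangent is
    -- the projection of the tangent plane of `S` at the point where `S` meets the line
    (∀ (T : EckardtTriple) (e : (Fin 5 → ℂ) ≃ₗ[ℂ] (Fin 5 → ℂ)) (k q c l : MvPolynomial (Fin 3) ℂ),
      IsAdapted T e k q c l →
      (∀ y : Fin 3 → ℂ, y ≠ 0 →
        (ResidualConicSingular T.F T.ℓ
            ((Submodule.span ℂ {y}).comap (stdProj ∘ₗ (e : (Fin 5 → ℂ) →ₗ[ℂ] (Fin 5 → ℂ)))) ↔
          eval y (k * c - q ^ 2) = 0 ∨ eval y l = 0)) ∧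
      (∀ H, IsFixedHyperplane T.F T.p H → ∀ w ∈ T.ℓ ⊓ H, w ≠ 0 → ∀ y : Fin 3 → ℂ,
        (∃ v ∈ H ⊓ tangentSpace T.F w, stdProj (e v) = y) ↔ eval y k = 0)) := by
  exact ⟨exists_projection_equiv, fun k q c l Q m hk hq hc hl =>
    isEckardtTriple_iff_isPresentation hk hq hc hl, exists_isAdapted, exists_isPresentation,
    fun T e k q c l h => h.exists_same_projection_iff, fun T => by
      obtain ⟨e, k, q, c, l, h⟩ := exists_isAdapted T
      exact ⟨_, (h.isFixedHyperplane_iff _).mpr rfl, fun H => (h.isFixedHyperplane_iff H).mp⟩,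
    fun T e k q c l h => ⟨fun y hy => h.residualConicSingular_iff hy,
      fun H hH w hw hw0 y => h.exists_mem_tangentSpace_iff hH hw hw0 y⟩⟩
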